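/- Let $d,n\ge 1$, let $v:\mathbb{R}^d\to\mathbb{R}^d$ be Lipschitz and bounded with flow $(\Phi^v_t)_{t\in\mathbb{R}}$ (that is, $t\mapsto\Phi^v_t(x)$ solves $\dot x=v(x)$, $x(0)=x$), and let $\omega\subset\mathbb{R}^d$ be bounded, open and connected. An admissible control is a function $\mathbb{1}_\omega u:\mathbb{R}^d\times\mathbb{R}^+\to\mathbb{R}^d$ that is bounded, Lipschitz in $x$ with a constant independent of $t$, and measurable in $t$ for each $x$. Let $X^0=\{x^0_1,\dots,x^0_n\}$ and $X^1=\{x^1_1,\dots,x^1_n\}$ be configurations, each consisting of $n$ pairwise distinct points of $\mathbb{R}^d$. Assume the geometric condition: for each $i$ there are $s,s'>0$ with $\Phi^v_{s}(x^0_i)\in\omega$ and $\Phi^v_{-s'}(x^1_i)\in\omega$. We say that exact control from $X^0$ to $X^1$ at time $T\ge 0$ is possible if there is an admissible control $\mathbb{1}_\omega u$ such that the solutions (Carathéodory solutions, i.e. absolutely continuous and satisfying the equation for a.e. $t$) of $$\dot x_i(t)=v(x_i(t))+\mathbb{1}_\omega(x_i(t))\,u(x_i(t),t),\qquad x_i(0)=x_i^0,\qquad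 i=1,\dots,n,$$ satisfy $\{x_1(T),\dots,x_n(T)\}=X^1$ (as configurations: the agents are interchangeable). Put $$t^0_i=\inf\{t\ge 0:\Phi^v_t(x^0_i)\in\omega\},\qquad t^1_i=\inf\{t\ge 0:\Phi^v_{-t}(x^1_i)\in\omega\},\qquad M^*_e=\max\{t^0_i,t^1_i: i=1,\dots,n\}.$$ Arrange $(t^0_i)_i$ in non-decreasing order and $(t^1_i)_i$ in non-increasing order, and, after this rearrangement, set $M_e=\max_{1\le i\le n}|t^0_i+t^1_i|$. Then: (i) for every $T>M_e$, exact control from $X^0$ to $X^1$ at time $T$ is possible; (ii) for every $T\in(M^*_e,M_e]$, exact control from $X^0$ to $X^1$ at time $T$ is impossible; (iii) there are at most finitely many $T\in[0,M^*_e]$ at which exact control from $X^0$ to $X^1$ is possible. -/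

import Mathlib

open MeasureTheory Set
open scoped NNReal ENNReal Topology

namespace CrowdControl

/-- The Carathéodory condition on the uncontrolled velocity `v`: Lipschitz and bounded. -/
structure IsAdmissibleVelocity {d : ℕ}
    (v : EuclideanSpace ℝ (Fin d) → EuclideanSpace ℝ (Fin d)) : Prop where
  lipschitz : ∃ L : ℝ≥0, LipschitzWith L v
  bounded : ∃ M : ℝ, 0 < M ∧ ∀ x, ‖v x‖ ≤ M

/-- The localized control `1_ω u`, as a function of the position and the time. -/
noncomputable def localizedControl {d : ℕ} (ω : Set (EuclideanSpace ℝ (Fin d)))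
    (u : EuclideanSpace ℝ (Fin d) → ℝ → EuclideanSpace ℝ (Fin d))
    (x : EuclideanSpace ℝ (Fin d)) (t : ℝ) : EuclideanSpace ℝ (Fin d) :=
  ω.indicator (fun y => u y t) x

/-- The Carathéodory condition on the control `1_ω u`: Lipschitz in space (with a constant that
does not depend on the time), measurable in time, and bounded. -/
structure IsAdmissibleControl {d : ℕ} (ω : Set (EuclideanSpace ℝ (Fin d)))
    (u : EuclideanSpace ℝ (Fin d) → ℝ → EuclideanSpace ℝ (Fin d)) : Prop where
  lipschitz : ∃ L : ℝ≥0, ∀ t, LipschitzWith L (fun x => localizedControl ω u x t)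
  measurable : ∀ x, Measurable (fun t => localizedControl ω u x t)
  bounded : ∃ M : ℝ, 0 < M ∧ ∀ x t, ‖localizedControl ω u x t‖ ≤ M

open Classical in
/-- The flow `Φ_t^v(x)`, `t ∈ ℝ`, of an autonomous vector field: the value at time `t` of the
integral curve of `v` that starts from `x` at time `0`. (The value is `x` if no such curve exists;
for an admissible velocity the curve exists and is unique, see `flow_spec` and `flow_unique`.) -/
noncomputable def flow {d : ℕ} (v : EuclideanSpace ℝ (Fin d) → EuclideanSpace ℝ (Fin d)) (t : ℝ)
    (x : EuclideanSpace ℝ (Fin d)) : EuclideanSpace ℝ (Fin d) :=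
  if h : ∃ γ : ℝ → EuclideanSpace ℝ (Fin d), γ 0 = x ∧ IsIntegralCurve γ (fun _ => v)
  then h.choose t else x

theorem exists_integralCurve {d : ℕ} {v : EuclideanSpace ℝ (Fin d) → EuclideanSpace ℝ (Fin d)}
    (hv : IsAdmissibleVelocity v) (x : EuclideanSpace ℝ (Fin d)) :
    ∃ γ : ℝ → EuclideanSpace ℝ (Fin d), γ 0 = x ∧ IsIntegralCurve γ (fun _ => v) := by
  obtain ⟨L, hL⟩ := hv.lipschitz
  obtain ⟨M, hM, hb⟩ := hv.bounded
  have key : ∀ k : ℕ, ∃ α : ℝ → EuclideanSpace ℝ (Fin d), α 0 = x ∧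
      ∀ t ∈ Ioo (-((k : ℝ) + 1)) (k + 1), HasDerivAt α (v (α t)) t := by
    intro k
    have hk : (0 : ℝ) < k + 1 := by positivity
    have hpl : IsPicardLindelof (fun _ => v) (tmin := -((k : ℝ) + 1)) (tmax := k + 1)
        ⟨0, by constructor <;> linarith⟩ x (⟨M, hM.le⟩ * ⟨(k : ℝ) + 1, hk.le⟩) 0 ⟨M, hM.le⟩ L :=
      { lipschitzOnWith := fun t _ => hL.lipschitzOnWith
        continuousOn := fun y _ => continuousOn_const
        norm_le := fun t _ y _ => hb y
        mul_max_le := by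
          simp
          rfl }
    obtain ⟨α, h0, hα⟩ := hpl.exists_eq_forall_mem_Icc_hasDerivWithinAt₀
    exact ⟨α, h0, fun t ht => (hα t (Ioo_subset_Icc_self ht)).hasDerivAt (Icc_mem_nhds ht.1 ht.2)⟩
  choose α h0 hα using key
  have agree : ∀ k l : ℕ, k ≤ l → EqOn (α k) (α l) (Ioo (-((k : ℝ) + 1)) (k + 1)) := by
    intro k l hkl
    have hk : (0 : ℝ) < k + 1 := by positivity
    have hkl' : (k : ℝ) ≤ l := by exact_mod_cast hkl
    refine ODE_solution_unique_of_mem_Ioo (v := fun _ => v) (s := fun _ => univ) (K := L) (t₀ := 0)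
      (fun t _ => hL.lipschitzOnWith) (by constructor <;> linarith)
      (fun t ht => ⟨hα k t ht, mem_univ _⟩)
      (fun t ht => ⟨hα l t ⟨by linarith [ht.1], by linarith [ht.2]⟩, mem_univ _⟩)
      (by rw [h0, h0])
  refine ⟨fun t => α ⌈|t|⌉₊ t, h0 _, fun t => ?_⟩
  have mem : ∀ s : ℝ, s ∈ Ioo (-((⌈|s|⌉₊ : ℝ) + 1)) (⌈|s|⌉₊ + 1) := fun s => by
    have h1 := Nat.le_ceil |s|
    have h2 := abs_le.1 h1
    constructor <;> linarith [h2.1, h2.2]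
  have hev : (fun s => α ⌈|s|⌉₊ s) =ᶠ[𝓝 t] α (⌈|t|⌉₊ + 1) := by
    have h1 : ∀ᶠ s in 𝓝 t, |s| < |t| + 1 :=
      continuous_abs.continuousAt.eventually_lt continuousAt_const (by linarith)
    filter_upwards [h1] with s hs
    refine agree _ _ (Nat.ceil_le.2 ?_) (mem s)
    push_cast
    linarith [Nat.le_ceil |t|]
  have hd := hα (⌈|t|⌉₊ + 1) t (by
    have := mem t
    push_cast
    constructor <;> linarith [this.1, this.2])
  have := hd.congr_of_eventuallyEq hev
  rwa [← hev.eq_of_nhds] at this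

theorem flow_spec {d : ℕ} {v : EuclideanSpace ℝ (Fin d) → EuclideanSpace ℝ (Fin d)}
    (hv : IsAdmissibleVelocity v) (x : EuclideanSpace ℝ (Fin d)) :
    flow v 0 x = x ∧ IsIntegralCurve (fun t => flow v t x) (fun _ => v) := by
  have h := exists_integralCurve hv x
  have e : (fun t => flow v t x) = h.choose := by
    funext t
    simp only [flow, dif_pos h]
  refine ⟨?_, e ▸ h.choose_spec.2⟩
  exact (congrFun e 0).trans h.choose_spec.1

theorem flow_unique {d : ℕ} {v : EuclideanSpace ℝ (Fin d) → EuclideanSpace ℝ (Fin d)}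
    (hv : IsAdmissibleVelocity v) {γ : ℝ → EuclideanSpace ℝ (Fin d)}
    (hγ : IsIntegralCurve γ (fun _ => v)) (t : ℝ) : flow v t (γ 0) = γ t := by
  obtain ⟨L, hL⟩ := hv.lipschitz
  have h := flow_spec hv (γ 0)
  have := ODE_solution_unique_univ (v := fun _ => v) (s := fun _ => univ) (K := L) (t₀ := 0)
    (f := fun t => flow v t (γ 0)) (g := γ) (fun t => hL.lipschitzOnWith)
    (fun t => ⟨h.2 t, mem_univ _⟩) (fun t => ⟨hγ t, mem_univ _⟩) h.1
  exact congrFun this t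

/-- A configuration `(x_1, …, x_n)` is disjoint if its points are pairwise distinct. -/
def IsDisjoint {d n : ℕ} (X : Fin n → EuclideanSpace ℝ (Fin d)) : Prop :=
  ∀ i j, i ≠ j → X i ≠ X j

/-- The empirical measure `(1/n) ∑ δ_{x_i}` of a configuration. -/
noncomputable def empiricalMeasure {d n : ℕ} (X : Fin n → EuclideanSpace ℝ (Fin d)) :
    Measure (EuclideanSpace ℝ (Fin d)) :=
  (n : ℝ≥0∞)⁻¹ • ∑ i, Measure.dirac (X i)

/-- The geometric condition: the flow of `v` carries each point of the support of `μ₀` into `ω`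
at some positive time, and each point of the support of `μ₁` at some negative time. -/
structure GeometricCondition {d : ℕ}
    (v : EuclideanSpace ℝ (Fin d) → EuclideanSpace ℝ (Fin d)) (ω : Set (EuclideanSpace ℝ (Fin d)))
    (μ₀ μ₁ : Measure (EuclideanSpace ℝ (Fin d))) : Prop where
  forward : ∀ x ∈ μ₀.support, ∃ t : ℝ, 0 < t ∧ flow v t x ∈ ω
  backward : ∀ x ∈ μ₁.support, ∃ t : ℝ, 0 < t ∧ flow v (-t) x ∈ ω

/-- `t⁰(x)`: the infimum of the times at which the trajectory from `x` is in `ω`. -/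
noncomputable def entryTime {d : ℕ} (v : EuclideanSpace ℝ (Fin d) → EuclideanSpace ℝ (Fin d))
    (ω : Set (EuclideanSpace ℝ (Fin d))) (x : EuclideanSpace ℝ (Fin d)) : ℝ :=
  sInf {t : ℝ | 0 ≤ t ∧ flow v t x ∈ ω}

/-- `t¹(x)`: the same infimum along the backward trajectory from `x`. -/
noncomputable def backwardEntryTime {d : ℕ}
    (v : EuclideanSpace ℝ (Fin d) → EuclideanSpace ℝ (Fin d))
    (ω : Set (EuclideanSpace ℝ (Fin d))) (x : EuclideanSpace ℝ (Fin d)) : ℝ :=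
  sInf {t : ℝ | 0 ≤ t ∧ flow v (-t) x ∈ ω}

/-- The non-decreasing rearrangement of a finite sequence. -/
noncomputable def sortAsc {n : ℕ} (f : Fin n → ℝ) : Fin n → ℝ := fun i => f (Tuple.sort f i)

/-- The non-increasing rearrangement of a finite sequence. -/
noncomputable def sortDesc {n : ℕ} (f : Fin n → ℝ) : Fin n → ℝ := fun i => f (Tuple.sort f i.rev)

/-- `M_e^*(X⁰, X¹) = max {t⁰_i, t¹_i}`. -/
noncomputable def MeStar {d n : ℕ} (v : EuclideanSpace ℝ (Fin d) → EuclideanSpace ℝ (Fin d))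
    (ω : Set (EuclideanSpace ℝ (Fin d))) (X₀ X₁ : Fin n → EuclideanSpace ℝ (Fin d)) : ℝ :=
  ⨆ i, max (entryTime v ω (X₀ i)) (backwardEntryTime v ω (X₁ i))

/-- `M_e(X⁰, X¹) = max_i |t⁰_i + t¹_i|`, where the `t⁰_i` are arranged non-decreasingly and the
`t¹_i` non-increasingly. -/
noncomputable def Me {d n : ℕ} (v : EuclideanSpace ℝ (Fin d) → EuclideanSpace ℝ (Fin d))
    (ω : Set (EuclideanSpace ℝ (Fin d))) (X₀ X₁ : Fin n → EuclideanSpace ℝ (Fin d)) : ℝ :=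
  ⨆ i, |sortAsc (fun j => entryTime v ω (X₀ j)) i
    + sortDesc (fun j => backwardEntryTime v ω (X₁ j)) i|

/-- `x` is the (Carathéodory) solution on `[0, T]` of
`x'(t) = v (x t) + 1_ω (x t) u (x t, t)` for a.e. `t`, `x(0) = x₀`, in integral form. -/
structure IsControlledTrajectory {d : ℕ}
    (v : EuclideanSpace ℝ (Fin d) → EuclideanSpace ℝ (Fin d)) (ω : Set (EuclideanSpace ℝ (Fin d)))
    (u : EuclideanSpace ℝ (Fin d) → ℝ → EuclideanSpace ℝ (Fin d)) (T : ℝ)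
    (x₀ : EuclideanSpace ℝ (Fin d)) (x : ℝ → EuclideanSpace ℝ (Fin d)) : Prop where
  integrable : IntervalIntegrable (fun s => v (x s) + localizedControl ω u (x s) s) volume 0 T
  integral_eq : ∀ t ∈ Icc 0 T, x t = x₀ + ∫ s in (0 : ℝ)..t, (v (x s) + localizedControl ω u (x s) s)

/-- Exact controllability from `X₀` to `X₁` at time `T`. The agents are interchangeable: the final
positions are those of `X₁` up to a relabelling. -/
def ExactlyControllable {d n : ℕ} (v : EuclideanSpace ℝ (Fin d) → EuclideanSpace ℝ (Fin d))
    (ω : Set (EuclideanSpace ℝ (Fin d))) (X₀ X₁ : Fin n → EuclideanSpace ℝ (Fin d)) (T : ℝ) :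
    Prop :=
  ∃ u : EuclideanSpace ℝ (Fin d) → ℝ → EuclideanSpace ℝ (Fin d), IsAdmissibleControl ω u ∧
    ∃ x : Fin n → ℝ → EuclideanSpace ℝ (Fin d),
      (∀ i, IsControlledTrajectory v ω u T (X₀ i) (x i)) ∧
      ∃ σ : Equiv.Perm (Fin n), ∀ i, x i T = X₁ (σ i)

end CrowdControl

/-! ### The free flow, entry times and the rearrangement inequality. -/

namespace CrowdControl

variable {d : ℕ} {v : EuclideanSpace ℝ (Fin d) → EuclideanSpace ℝ (Fin d)}
  {ω : Set (EuclideanSpace ℝ (Fin d))}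

/-! Control acts only in `ω`, so an agent follows the free flow until that flow first meets `ω`,
and, read backwards from its target, follows it again after its last visit. If `T` exceeds `t⁰_i`
and `t¹_j`, an agent going from `X₀ i` to `X₁ j` must satisfy `t⁰_i + t¹_j < T`: otherwise the two
free stretches cover `[0, T]`, the whole motion is the free flow, and openness of `ω` yields the
strict inequality after all (`entryTime_add_backwardEntryTime_lt`, `IsControlledTrajectory.add_lt`).
Pairing increasing with decreasing times minimizes the largest sum (`add_lt_of_forall_perm_add_lt`),
which proves (ii). If `T ≤ M*_e`, some agent, possibly after time reversal, is free on all of `[0,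
T]`. Free motion is injective before entry (`Reaches.flow_injOn`), so this agent is at each of the
`n` targets at most once; this is (iii).

For (i) it suffices to find Lipschitz curves that never meet, that are free outside a time window
and that stay in `ω` during it: bumps carried along the curves then form an admissible control
(`exactlyControllable_of_curves`). If `d ≥ 2`, graphs of Lipschitz curves in space-time have
Hausdorff dimension at most `1 < d`, so a generic curve in the connected set `ω` avoids them, and
the windows can be filled one agent at a time with the sorted pairing (`exists_disjoint_curves`).

If `d = 1`, agents cannot overtake each other and the pairing must preserve the order. It is still
optimal, because entry times are monotone in position (`add_lt_of_strictMono`). The ordered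
positions allowed at a given time form a nonempty convex set, and a partition of unity selects `C¹`
curves from these sets (`exists_ordered_curves`). -/

theorem IsAdmissibleVelocity.neg (hv : IsAdmissibleVelocity v) : IsAdmissibleVelocity (-v) := by
  obtain ⟨L, hL⟩ := hv.lipschitz
  obtain ⟨M, hM, hb⟩ := hv.bounded
  exact ⟨⟨L, hL.neg⟩, M, hM, fun x => by simpa using hb x⟩

theorem flow_zero (hv : IsAdmissibleVelocity v) (x : EuclideanSpace ℝ (Fin d)) : flow v 0 x = x :=
  (flow_spec hv x).1

theorem hasDerivAt_flow (hv : IsAdmissibleVelocity v) (x : EuclideanSpace ℝ (Fin d)) (t : ℝ) :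
    HasDerivAt (fun t => flow v t x) (v (flow v t x)) t :=
  (flow_spec hv x).2 t

theorem continuous_flow (hv : IsAdmissibleVelocity v) (x : EuclideanSpace ℝ (Fin d)) :
    Continuous (fun t => flow v t x) :=
  continuous_iff_continuousAt.2 fun t => (hasDerivAt_flow hv x t).continuousAt

theorem exists_lipschitzWith_flow (hv : IsAdmissibleVelocity v) :
    ∃ K : ℝ≥0, ∀ x, LipschitzWith K (fun t => flow v t x) := by
  obtain ⟨M, hM, hb⟩ := hv.bounded
  refine ⟨⟨M, hM.le⟩, fun x => ?_⟩
  refine lipschitzWith_of_nnnorm_deriv_le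
    (fun t => (hasDerivAt_flow hv x t).differentiableAt) fun t => ?_
  rw [(hasDerivAt_flow hv x t).deriv]
  exact hb _

theorem flow_add (hv : IsAdmissibleVelocity v) (s t : ℝ) (x : EuclideanSpace ℝ (Fin d)) :
    flow v (s + t) x = flow v s (flow v t x) := by
  have h : IsIntegralCurve (fun r => flow v (r + t) x) (fun _ => v) := fun r => by
    simpa using (hasDerivAt_flow hv x (r + t)).comp_add_const r t
  have := flow_unique hv h s
  simp only [zero_add] at this
  exact this.symm

theorem flow_neg (hv : IsAdmissibleVelocity v) (t : ℝ) (x : EuclideanSpace ℝ (Fin d)) :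
    flow (-v) t x = flow v (-t) x := by
  have h : IsIntegralCurve (fun r => flow v (-r) x) (fun _ => -v) := fun r => by
    have := (hasDerivAt_flow hv x (-r)).scomp r (hasDerivAt_neg r)
    simpa [Function.comp_def] using this
  have := flow_unique hv.neg h t
  simpa [flow_zero hv] using this

theorem flow_neg_flow (hv : IsAdmissibleVelocity v) (t : ℝ) (x : EuclideanSpace ℝ (Fin d)) :
    flow v (-t) (flow v t x) = x := by
  rw [← flow_add hv, neg_add_cancel, flow_zero hv]

theorem flow_flow_neg (hv : IsAdmissibleVelocity v) (t : ℝ) (x : EuclideanSpace ℝ (Fin d)) :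
    flow v t (flow v (-t) x) = x := by
  rw [← flow_add hv, add_neg_cancel, flow_zero hv]

theorem flow_injective (hv : IsAdmissibleVelocity v) (t : ℝ) : Function.Injective (flow v t) :=
  fun x y h => by rw [← flow_neg_flow hv t x, h, flow_neg_flow hv]

/-- The forward trajectory from `x` reaches `ω`. -/
def Reaches (v : EuclideanSpace ℝ (Fin d) → EuclideanSpace ℝ (Fin d))
    (ω : Set (EuclideanSpace ℝ (Fin d))) (x : EuclideanSpace ℝ (Fin d)) : Prop :=
  ∃ t : ℝ, 0 < t ∧ flow v t x ∈ ω

/-- Lets every fact about entry times serve at the targets too, with `-v` in place of `v`. -/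
theorem backwardEntryTime_eq (hv : IsAdmissibleVelocity v) (x : EuclideanSpace ℝ (Fin d)) :
    backwardEntryTime v ω x = entryTime (-v) ω x := by
  simp only [backwardEntryTime, entryTime, flow_neg hv]

theorem entryTime_nonneg (x : EuclideanSpace ℝ (Fin d)) : 0 ≤ entryTime v ω x :=
  Real.sInf_nonneg fun _ h => h.1

theorem entryTime_le {x : EuclideanSpace ℝ (Fin d)} {t : ℝ} (ht : 0 ≤ t) (h : flow v t x ∈ ω) :
    entryTime v ω x ≤ t :=
  csInf_le ⟨0, fun _ h => h.1⟩ ⟨ht, h⟩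

theorem flow_notMem_of_lt_entryTime {x : EuclideanSpace ℝ (Fin d)} {t : ℝ} (ht : 0 ≤ t)
    (h : t < entryTime v ω x) : flow v t x ∉ ω :=
  fun h' => (entryTime_le ht h').not_gt h

theorem entryTime_eq_zero (hv : IsAdmissibleVelocity v) {x : EuclideanSpace ℝ (Fin d)}
    (h : x ∈ ω) : entryTime v ω x = 0 :=
  le_antisymm (entryTime_le le_rfl (by rwa [flow_zero hv])) (entryTime_nonneg x)

theorem Reaches.exists_lt {x : EuclideanSpace ℝ (Fin d)} (h : Reaches v ω x) {c : ℝ}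
    (hc : entryTime v ω x < c) : ∃ t, 0 ≤ t ∧ t < c ∧ flow v t x ∈ ω := by
  obtain ⟨s, hs, hs'⟩ := h
  obtain ⟨t, ht, htc⟩ := exists_lt_of_csInf_lt (s := {t : ℝ | 0 ≤ t ∧ flow v t x ∈ ω})
    ⟨s, hs.le, hs'⟩ hc
  exact ⟨t, ht.1, htc, ht.2⟩

theorem exists_gt_flow_mem (hv : IsAdmissibleVelocity v) (hω : IsOpen ω)
    {x : EuclideanSpace ℝ (Fin d)} {t c : ℝ} (h : flow v t x ∈ ω) (hc : t < c) :
    ∃ s, t < s ∧ s < c ∧ flow v s x ∈ ω := by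
  have h1 : ∀ᶠ s in 𝓝 t, flow v s x ∈ ω :=
    (continuous_flow hv x).continuousAt.eventually_mem (hω.mem_nhds h)
  have h2 : ∀ᶠ s in 𝓝[>] t, s ∈ Ioo t c := Ioo_mem_nhdsGT hc
  obtain ⟨s, hs, hs'⟩ := ((h1.filter_mono nhdsWithin_le_nhds).and h2).exists
  exact ⟨s, hs'.1, hs'.2, hs⟩

theorem exists_lt_flow_mem (hv : IsAdmissibleVelocity v) (hω : IsOpen ω)
    {x : EuclideanSpace ℝ (Fin d)} {t c : ℝ} (h : flow v t x ∈ ω) (hc : c < t) :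
    ∃ s, c < s ∧ s < t ∧ flow v s x ∈ ω := by
  have h1 : ∀ᶠ s in 𝓝 t, flow v s x ∈ ω :=
    (continuous_flow hv x).continuousAt.eventually_mem (hω.mem_nhds h)
  have h2 : ∀ᶠ s in 𝓝[<] t, s ∈ Ioo c t := Ioo_mem_nhdsLT hc
  obtain ⟨s, hs, hs'⟩ := ((h1.filter_mono nhdsWithin_le_nhds).and h2).exists
  exact ⟨s, hs'.1, hs'.2, hs⟩

/-- If the uncontrolled flow steers `x` to `y` within the time `T`, and `ω` is met on the way, then
the total time spent before the first and after the last visit to `ω` is less than `T`. -/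
theorem entryTime_add_backwardEntryTime_lt (hv : IsAdmissibleVelocity v) (hω : IsOpen ω)
    {x y : EuclideanSpace ℝ (Fin d)} {T : ℝ} (hx : Reaches v ω x) (hxy : flow v T x = y)
    (hT : entryTime v ω x < T) : entryTime v ω x + backwardEntryTime v ω y < T := by
  obtain ⟨s, hs0, hsT, hs⟩ := hx.exists_lt hT
  obtain ⟨r, hsr, hrT, hr⟩ := exists_gt_flow_mem hv hω hs hsT
  have h1 := entryTime_le hs0 hs
  have h2 : entryTime (-v) ω y ≤ T - r := by
    refine entryTime_le (by linarith) ?_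
    rw [flow_neg hv, ← hxy, ← flow_add hv]
    simpa using hr
  rw [backwardEntryTime_eq hv]
  linarith

/-- Turns the geometric condition, phrased on supports, into a condition on each agent. -/
theorem mem_support_empiricalMeasure {n : ℕ} (X : Fin n → EuclideanSpace ℝ (Fin d)) (i : Fin n) :
    X i ∈ (empiricalMeasure X).support := by
  rw [Measure.mem_support_iff_forall]
  intro U hU
  obtain ⟨V, hVU, hV, hxV⟩ := mem_nhds_iff.1 hU
  refine lt_of_lt_of_le ?_ (measure_mono hVU)
  rw [empiricalMeasure, Measure.smul_apply, smul_eq_mul, Measure.finsetSum_apply]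
  refine ENNReal.mul_pos (by simp) (ne_of_gt ?_)
  refine lt_of_lt_of_le ?_ (Finset.single_le_sum (f := fun j => Measure.dirac (X j) V)
    (fun _ _ => zero_le) (Finset.mem_univ i))
  simp [Measure.dirac_apply' _ hV.measurableSet, hxV]

/-- A finite rearrangement inequality: pairing a monotone with an antitone family minimizes the
largest sum. -/
theorem add_lt_of_forall_perm_add_lt {n : ℕ} {f g : Fin n → ℝ} (hf : Monotone f) (hg : Antitone g)
    (σ τ : Equiv.Perm (Fin n)) {M : ℝ} (h : ∀ k, f (σ k) + g (τ k) < M) (i : Fin n) :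
    f i + g i < M := by
  by_contra! hi
  have key : ∀ k, σ k ∈ Finset.Ici i → τ k ∈ Finset.Ioi i := fun k hk => by
    rw [Finset.mem_Ici] at hk
    rw [Finset.mem_Ioi]
    by_contra! hk'
    linarith [h k, hf hk, hg hk']
  -- By `key`, `Ici i` would inject into `Ioi i`, which has one element fewer.
  have : (Finset.Ici i).card ≤ (Finset.Ioi i).card := by
    refine Finset.card_le_card_of_injOn (fun j => τ (σ.symm j)) (fun j hj => ?_) ?_
    · exact key _ (by simpa using hj)
    · exact (τ.injective.comp σ.symm.injective).injOn
  simp only [Fin.card_Ici, Fin.card_Ioi] at this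
  omega

end CrowdControl

/-! ### Necessary conditions: the free stretches of a controlled trajectory. -/

namespace CrowdControl

variable {d : ℕ} {v : EuclideanSpace ℝ (Fin d) → EuclideanSpace ℝ (Fin d)}
  {ω : Set (EuclideanSpace ℝ (Fin d))}

/-- Grönwall's lemma in integral form, for a vanishing initial value. -/
theorem eq_zero_of_le_mul_integral {f : ℝ → ℝ} {K τ : ℝ} (hf : ContinuousOn f (Icc 0 τ))
    (h0 : ∀ t ∈ Icc 0 τ, 0 ≤ f t) (h : ∀ t ∈ Icc 0 τ, f t ≤ K * ∫ s in (0 : ℝ)..t, f s) :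
    ∀ t ∈ Icc 0 τ, f t = 0 := by
  intro t ht
  have hτ : 0 ≤ τ := ht.1.trans ht.2
  -- The constant extension beyond the interval is continuous on `ℝ`, so its primitive is
  -- differentiable at every point, endpoints included.
  set g : ℝ → ℝ := IccExtend hτ ((Icc 0 τ).domRestrict f) with hg
  have hgc : Continuous g := hf.domRestrict.Icc_extend'
  have hgf : ∀ s ∈ Icc 0 τ, g s = f s := fun s hs => by
    rw [hg, IccExtend_of_mem _ _ hs, domRestrict_apply]
  have hint : ∀ t ∈ Icc 0 τ, ∫ s in (0 : ℝ)..t, f s = ∫ s in (0 : ℝ)..t, g s := fun t ht =>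
    intervalIntegral.integral_congr fun s hs => by
      rw [uIcc_of_le ht.1] at hs
      exact (hgf s ⟨hs.1, hs.2.trans ht.2⟩).symm
  have hI : ∀ t, HasDerivAt (fun t => ∫ s in (0 : ℝ)..t, g s) (g t) t := fun t =>
    intervalIntegral.integral_hasDerivAt_right (hgc.intervalIntegrable _ _)
      hgc.stronglyMeasurable.stronglyMeasurableAtFilter hgc.continuousAt
  have hz : ∀ t ∈ Icc 0 τ, ∫ s in (0 : ℝ)..t, g s = 0 := by
    refine eq_zero_of_abs_deriv_le_mul_abs_self_of_eq_zero_right (f' := g) (K := K)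
      (fun t _ => (hI t).continuousAt.continuousWithinAt) (fun t _ => (hI t).hasDerivWithinAt)
      (by simp) fun t ht => ?_
    have ht' := Ico_subset_Icc_self ht
    rw [hgf t ht', Real.norm_of_nonneg (h0 t ht'), Real.norm_of_nonneg, ← hint t ht']
    · exact h t ht'
    · refine intervalIntegral.integral_nonneg ht.1 fun s hs => ?_
      have hs' : s ∈ Icc 0 τ := ⟨hs.1, hs.2.trans ht'.2⟩
      rw [hgf s hs']
      exact h0 s hs'
  refine le_antisymm ?_ (h0 t ht)
  have := h t ht
  rwa [hint t ht, hz t ht, mul_zero] at this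

variable {u : EuclideanSpace ℝ (Fin d) → ℝ → EuclideanSpace ℝ (Fin d)} {T : ℝ}
  {x₀ : EuclideanSpace ℝ (Fin d)} {x : ℝ → EuclideanSpace ℝ (Fin d)}

theorem IsControlledTrajectory.continuousOn (h : IsControlledTrajectory v ω u T x₀ x) :
    ContinuousOn x (Icc 0 T) := by
  rcases le_or_gt 0 T with hT | hT
  · have h1 := intervalIntegral.continuousOn_primitive_interval' h.integrable left_mem_uIcc
    rw [uIcc_of_le hT] at h1
    exact (continuousOn_const.add h1).congr h.integral_eq
  · simp [hT]

theorem IsControlledTrajectory.initial (h : IsControlledTrajectory v ω u T x₀ x) (hT : 0 ≤ T) :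
    x 0 = x₀ := by
  simpa using h.integral_eq 0 ⟨le_rfl, hT⟩

theorem flow_eq_add_integral (hv : IsAdmissibleVelocity v) (x : EuclideanSpace ℝ (Fin d)) (t : ℝ) :
    flow v t x = x + ∫ s in (0 : ℝ)..t, v (flow v s x) := by
  obtain ⟨L, hL⟩ := hv.lipschitz
  rw [intervalIntegral.integral_eq_sub_of_hasDerivAt (fun s _ => hasDerivAt_flow hv x s)
    ((hL.continuous.comp (continuous_flow hv x)).intervalIntegrable _ _), flow_zero hv]
  abel

/-- A controlled trajectory follows the uncontrolled flow as long as the latter stays away from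
the control region. -/
theorem IsControlledTrajectory.eq_flow (h : IsControlledTrajectory v ω u T x₀ x)
    (hv : IsAdmissibleVelocity v)
    (hu : ∃ L : ℝ≥0, ∀ t, LipschitzWith L (fun x => localizedControl ω u x t)) {τ : ℝ} (hτT : τ ≤ T)
    (hτ : ∀ t, 0 ≤ t → t < τ → flow v t x₀ ∉ ω) {t : ℝ} (ht : t ∈ Icc 0 τ) :
    x t = flow v t x₀ := by
  obtain ⟨L, hL⟩ := hv.lipschitz
  obtain ⟨C, hC⟩ := hu
  have hcont : ContinuousOn (fun t => ‖x t - flow v t x₀‖) (Icc 0 τ) :=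
    ((h.continuousOn.mono (Icc_subset_Icc_right hτT)).sub (continuous_flow hv x₀).continuousOn).norm
  have := eq_zero_of_le_mul_integral (K := (L + C : ℝ≥0)) hcont (fun t _ => norm_nonneg _) ?_ t ht
  · exact sub_eq_zero.1 (norm_eq_zero.1 this)
  intro t ht
  have hsub : uIcc 0 t ⊆ uIcc 0 T := by
    rw [uIcc_of_le ht.1, uIcc_of_le (ht.1.trans (ht.2.trans hτT))]
    exact Icc_subset_Icc_right (ht.2.trans hτT)
  have hvi : IntervalIntegrable (fun s => v (flow v s x₀)) volume 0 t :=
    (hL.continuous.comp (continuous_flow hv x₀)).intervalIntegrable _ _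
  rw [h.integral_eq t ⟨ht.1, ht.2.trans hτT⟩, flow_eq_add_integral hv x₀ t, add_sub_add_left_eq_sub,
    ← intervalIntegral.integral_sub (h.integrable.mono_set hsub) hvi,
    ← intervalIntegral.integral_const_mul]
  refine intervalIntegral.norm_integral_le_of_norm_le ht.1 ?_ ?_
  -- At the last instant `τ` the free trajectory may already be in `ω`; one instant is negligible in
  -- the integral.
  · have hne : ∀ᵐ s ∂(volume : Measure ℝ), s ≠ t := by
      simp [ae_iff]
    filter_upwards [hne] with s hst hs
    have h0 : localizedControl ω u (flow v s x₀) s = 0 :=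
      indicator_of_notMem (hτ s hs.1.le ((lt_of_le_of_ne hs.2 hst).trans_le ht.2)) _
    have h1 := hL.dist_le_mul (x s) (flow v s x₀)
    have h2 := (hC s).dist_le_mul (x s) (flow v s x₀)
    simp only [h0, dist_eq_norm, sub_zero] at h1 h2
    calc ‖v (x s) + localizedControl ω u (x s) s - v (flow v s x₀)‖
        = ‖(v (x s) - v (flow v s x₀)) + localizedControl ω u (x s) s‖ := by congr 1; abel
      _ ≤ _ := norm_add_le _ _
      _ ≤ _ := add_le_add h1 h2
      _ = _ := by push_cast; ring
  · refine ContinuousOn.intervalIntegrable_of_Icc ht.1 ?_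
    exact continuousOn_const.mul (hcont.mono (Icc_subset_Icc_right ht.2))

theorem localizedControl_reverse (y : EuclideanSpace ℝ (Fin d)) (t : ℝ) :
    localizedControl ω (fun y t => -u y (T - t)) y t = -localizedControl ω u y (T - t) := by
  by_cases hy : y ∈ ω <;> simp [localizedControl, hy]

theorem IsAdmissibleControl.reverse (hu : IsAdmissibleControl ω u) (T : ℝ) :
    IsAdmissibleControl ω (fun y t => -u y (T - t)) := by
  obtain ⟨L, hL⟩ := hu.lipschitz
  obtain ⟨M, hM, hb⟩ := hu.bounded
  refine ⟨⟨L, fun t => ?_⟩, fun x => ?_, M, hM, fun x t => ?_⟩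
  · simp only [localizedControl_reverse]
    exact (hL (T - t)).neg
  · simp only [localizedControl_reverse]
    exact ((hu.measurable x).comp (measurable_const.sub measurable_id)).neg
  · simpa only [localizedControl_reverse, norm_neg] using hb x (T - t)

/-- The substitution `s ↦ T - s` in the integral equation changes the sign of both velocity and
control. It transfers statements about the start of a trajectory to its end. -/
theorem IsControlledTrajectory.reverse (h : IsControlledTrajectory v ω u T x₀ x) (hT : 0 ≤ T) :
    IsControlledTrajectory (-v) ω (fun y t => -u y (T - t)) T (x T) (fun t => x (T - t)) := by
  have e : (fun s => (-v) (x (T - s)) + localizedControl ω (fun y t => -u y (T - t)) (x (T - s)) s)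
      = fun s => -(fun s => v (x s) + localizedControl ω u (x s) s) (T - s) := by
    funext s
    simp only [localizedControl_reverse, Pi.neg_apply, neg_add]
  constructor
  · rw [e]
    have := (h.integrable.comp_sub_left T).neg
    simp only [sub_zero, sub_self] at this
    exact this.symm
  · intro t ht
    have h1 := h.integral_eq (T - t) ⟨by linarith [ht.2], by linarith [ht.1]⟩
    have h2 := h.integral_eq T ⟨hT, le_rfl⟩
    rw [e, intervalIntegral.integral_neg,
      intervalIntegral.integral_comp_sub_left (fun s => v (x s) + localizedControl ω u (x s) s) T,
      sub_zero, h1, h2]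
    have hsub : uIcc 0 (T - t) ⊆ uIcc 0 T := by
      rw [uIcc_of_le (by linarith [ht.2]), uIcc_of_le hT]
      exact Icc_subset_Icc_right (by linarith [ht.1])
    have hsub' : uIcc (T - t) T ⊆ uIcc 0 T := by
      rw [uIcc_of_le (by linarith [ht.1]), uIcc_of_le hT]
      exact Icc_subset_Icc_left (by linarith [ht.2])
    rw [← intervalIntegral.integral_add_adjacent_intervals (h.integrable.mono_set hsub)
      (h.integrable.mono_set hsub')]
    abel

theorem IsControlledTrajectory.eq_flow_neg (h : IsControlledTrajectory v ω u T x₀ x) (hT : 0 ≤ T)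
    (hv : IsAdmissibleVelocity v) (hu : IsAdmissibleControl ω u) {τ : ℝ} (hτT : τ ≤ T)
    (hτ : ∀ t, 0 ≤ t → t < τ → flow v (-t) (x T) ∉ ω) {t : ℝ} (ht : t ∈ Icc 0 τ) :
    x (T - t) = flow v (-t) (x T) := by
  rw [← flow_neg hv]
  exact (h.reverse hT).eq_flow hv.neg (hu.reverse T).lipschitz hτT
    (by simpa only [flow_neg hv] using hτ) ht

/-- A controlled trajectory on `[0, T]` that can reach and be reached from the control region
before its ends spends there a positive time. -/
theorem IsControlledTrajectory.add_lt (h : IsControlledTrajectory v ω u T x₀ x)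
    (hv : IsAdmissibleVelocity v) (hu : IsAdmissibleControl ω u) (hω : IsOpen ω)
    (hx₀ : Reaches v ω x₀) (h0 : entryTime v ω x₀ < T) (h1 : backwardEntryTime v ω (x T) < T) :
    entryTime v ω x₀ + backwardEntryTime v ω (x T) < T := by
  by_contra! hlt
  have hT : 0 ≤ T := (entryTime_nonneg x₀).trans h0.le
  rw [backwardEntryTime_eq hv] at h1 hlt
  have hb : 0 ≤ entryTime (-v) ω (x T) := entryTime_nonneg _
  -- If the sum is at least `T`, the instant `T - t¹` lies in both free stretches; gluing there
  -- shows that the free flow carries `x₀` to `x T`.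
  have e0 := h.eq_flow hv hu.lipschitz h0.le (fun t ht h' => flow_notMem_of_lt_entryTime ht h')
    (t := T - entryTime (-v) ω (x T)) ⟨by linarith, by linarith⟩
  have e1 := h.eq_flow_neg hT hv hu h1.le
    (fun t ht h' => by rw [← flow_neg hv]; exact flow_notMem_of_lt_entryTime ht h')
    (t := entryTime (-v) ω (x T)) ⟨hb, le_rfl⟩
  have e : flow v T x₀ = x T := by
    rw [e0] at e1
    have := congrArg (flow v (entryTime (-v) ω (x T))) e1
    rwa [flow_flow_neg hv, ← flow_add hv, add_sub_cancel] at this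
  have := entryTime_add_backwardEntryTime_lt hv hω hx₀ e h0
  rw [backwardEntryTime_eq hv] at this
  linarith

/-- The uncontrolled flow does not visit a point twice before it reaches `ω`. -/
theorem Reaches.flow_injOn (hv : IsAdmissibleVelocity v) (hx₀ : Reaches v ω x₀) :
    InjOn (fun t => flow v t x₀) (Icc 0 (entryTime v ω x₀)) := by
  have key : ∀ s t, 0 ≤ s → s < t → t ≤ entryTime v ω x₀ → flow v s x₀ ≠ flow v t x₀ := by
    intro s t hs hst ht h
    obtain ⟨r, hr, hrω⟩ := hx₀
    -- A repeated position makes the trajectory periodic, so a visit to `ω` at time `r` recurs at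
    -- some time in `[s, t)`, before the entry time.
    have hp : Function.Periodic (fun r => flow v r x₀) (t - s) := fun r => by
      have : r + (t - s) = (r - s) + t := by ring
      simp only
      rw [this, flow_add hv, ← h, ← flow_add hv]
      congr 1
      ring
    obtain ⟨r', hr', he⟩ := hp.exists_mem_Ico (sub_pos.2 hst) r s
    refine flow_notMem_of_lt_entryTime (v := v) (ω := ω) (x := x₀) (t := r') (hs.trans hr'.1) ?_ ?_
    · have := hr'.2
      linarith
    · rw [← he]
      exact hrω
  intro s hs t ht h
  rcases lt_trichotomy s t with h' | h' | h'
  · exact absurd h (key s t hs.1 h' ht.2)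
  · exact h'
  · exact absurd h.symm (key t s ht.1 h' hs.2)

theorem ExactlyControllable.reverse {n : ℕ} {X₀ X₁ : Fin n → EuclideanSpace ℝ (Fin d)}
    (h : ExactlyControllable v ω X₀ X₁ T) (hT : 0 ≤ T) : ExactlyControllable (-v) ω X₁ X₀ T := by
  obtain ⟨u, hu, x, hx, σ, hσ⟩ := h
  refine ⟨_, hu.reverse T, fun i t => x (σ.symm i) (T - t), fun i => ?_, σ.symm, fun i => ?_⟩
  · have := (hx (σ.symm i)).reverse hT
    rwa [hσ, Equiv.apply_symm_apply] at this
  · simpa using (hx (σ.symm i)).initial hT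

/-- There are at most finitely many times of exact control before all agents can have reached the
control region. -/
theorem finite_setOf_exactlyControllable_le_entryTime {n : ℕ}
    {X₀ X₁ : Fin n → EuclideanSpace ℝ (Fin d)} (hv : IsAdmissibleVelocity v)
    (hX₀ : ∀ i, Reaches v ω (X₀ i)) (i : Fin n) :
    {T | T ∈ Icc 0 (entryTime v ω (X₀ i)) ∧ ExactlyControllable v ω X₀ X₁ T}.Finite := by
  have hfin : (⋃ j : Fin n, {T | T ∈ Icc 0 (entryTime v ω (X₀ i)) ∧
      flow v T (X₀ i) = X₁ j}).Finite := by
    -- By injectivity of the free motion, each target contributes at most one time.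
    refine finite_iUnion fun j => Set.Subsingleton.finite fun s hs t ht => ?_
    exact (hX₀ i).flow_injOn hv hs.1 ht.1 (hs.2.trans ht.2.symm)
  refine hfin.subset ?_
  rintro T ⟨hT, u, hu, x, hx, σ, hσ⟩
  refine mem_iUnion.2 ⟨σ i, hT, ?_⟩
  rw [← hσ i, (hx i).eq_flow hv hu.lipschitz le_rfl
    (fun t ht h' => flow_notMem_of_lt_entryTime ht (h'.trans_le hT.2)) ⟨hT.1, le_rfl⟩]

theorem sortAsc_monotone {n : ℕ} (f : Fin n → ℝ) : Monotone (sortAsc f) := Tuple.monotone_sort f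

theorem sortDesc_antitone {n : ℕ} (f : Fin n → ℝ) : Antitone (sortDesc f) :=
  fun _ _ h => Tuple.monotone_sort f (Fin.rev_le_rev.2 h)

/-- Any successful relabelling `σ` bounds all its paired sums by `T`, and the sorted pairing does at
least as well. -/
theorem ExactlyControllable.me_lt {n : ℕ} (hn : 0 < n) {X₀ X₁ : Fin n → EuclideanSpace ℝ (Fin d)}
    (h : ExactlyControllable v ω X₀ X₁ T)
    (hv : IsAdmissibleVelocity v) (hω : IsOpen ω) (hX₀ : ∀ i, Reaches v ω (X₀ i))
    (hT : MeStar v ω X₀ X₁ < T) : Me v ω X₀ X₁ < T := by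
  obtain ⟨u, hu, x, hx, σ, hσ⟩ := h
  have : Nonempty (Fin n) := ⟨⟨0, hn⟩⟩
  have hle : ∀ i, max (entryTime v ω (X₀ i)) (backwardEntryTime v ω (X₁ i)) < T := fun i =>
    (le_ciSup (Set.finite_range _).bddAbove i).trans_lt hT
  have key : ∀ i, entryTime v ω (X₀ i) + backwardEntryTime v ω (X₁ (σ i)) < T := fun i => by
    have h0 := (max_lt_iff.1 (hle i)).1
    have h1 := (max_lt_iff.1 (hle (σ i))).2
    rw [← hσ] at h1 ⊢
    exact (hx i).add_lt hv hu hω (hX₀ i) h0 h1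
  obtain ⟨i, hi⟩ := exists_eq_ciSup_of_finite (f := fun i =>
    |sortAsc (fun j => entryTime v ω (X₀ j)) i
      + sortDesc (fun j => backwardEntryTime v ω (X₁ j)) i|)
  have hpos : 0 ≤ sortAsc (fun j => entryTime v ω (X₀ j)) i
      + sortDesc (fun j => backwardEntryTime v ω (X₁ j)) i := by
    simp only [sortAsc, sortDesc, backwardEntryTime_eq hv]
    exact add_nonneg (entryTime_nonneg _) (entryTime_nonneg _)
  rw [Me, ← hi, abs_of_nonneg hpos]
  -- The two permutations send agent `k` to its rank among the `t⁰` and its target to its rank among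
  -- the `t¹`; `Fin.revPerm` accounts for the decreasing order.
  refine add_lt_of_forall_perm_add_lt (sortAsc_monotone _) (sortDesc_antitone _)
    (Tuple.sort fun j => entryTime v ω (X₀ j)).symm
    (σ.trans ((Tuple.sort fun j => backwardEntryTime v ω (X₁ j)).symm.trans Fin.revPerm))
    (fun k => ?_) i
  simpa [sortAsc, sortDesc] using key k

/-- The maximum `M*_e` is attained at some index, either by an initial entry time or by a backward
one; the second case is the first for the reversed problem. -/
theorem finite_setOf_exactlyControllable_le_meStar {n : ℕ} (hn : 0 < n)
    {X₀ X₁ : Fin n → EuclideanSpace ℝ (Fin d)} (hv : IsAdmissibleVelocity v)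
    (hX₀ : ∀ i, Reaches v ω (X₀ i)) (hX₁ : ∀ i, Reaches (-v) ω (X₁ i)) :
    {T | T ∈ Icc 0 (MeStar v ω X₀ X₁) ∧ ExactlyControllable v ω X₀ X₁ T}.Finite := by
  have : Nonempty (Fin n) := ⟨⟨0, hn⟩⟩
  obtain ⟨i, hi⟩ := exists_eq_ciSup_of_finite (f := fun i =>
    max (entryTime v ω (X₀ i)) (backwardEntryTime v ω (X₁ i)))
  refine ((finite_setOf_exactlyControllable_le_entryTime (X₁ := X₁) hv hX₀ i).union
    (finite_setOf_exactlyControllable_le_entryTime (X₁ := X₀) hv.neg hX₁ i)).subset ?_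
  rintro T ⟨hT, h⟩
  rw [MeStar, ← hi] at hT
  rcases le_max_iff.1 hT.2 with h' | h'
  · exact Or.inl ⟨⟨hT.1, h'⟩, h⟩
  · exact Or.inr ⟨⟨hT.1, by rwa [← backwardEntryTime_eq hv]⟩, h.reverse hT.1⟩

end CrowdControl

/-! ### Realizing prescribed curves by an admissible control. -/

namespace CrowdControl

variable {d : ℕ} {v : EuclideanSpace ℝ (Fin d) → EuclideanSpace ℝ (Fin d)}
  {ω : Set (EuclideanSpace ℝ (Fin d))}

theorem intervalIntegrable_deriv_of_lipschitzWith {K : ℝ≥0} {f : ℝ → EuclideanSpace ℝ (Fin d)}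
    (hf : LipschitzWith K f) (a b : ℝ) : IntervalIntegrable (deriv f) volume a b := by
  refine (intervalIntegrable_const (c := (K : ℝ))).mono_fun
    (measurable_deriv f).aestronglyMeasurable (Filter.Eventually.of_forall fun t => ?_)
  simpa using norm_deriv_le_of_lipschitz hf

/-- Each coordinate is a real Lipschitz function, hence absolutely continuous, and equals the
integral of its derivative. -/
theorem integral_deriv_of_lipschitzWith {K : ℝ≥0} {f : ℝ → EuclideanSpace ℝ (Fin d)}
    (hf : LipschitzWith K f) (a b : ℝ) : ∫ t in a..b, deriv f t = f b - f a := by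
  ext k
  set P : EuclideanSpace ℝ (Fin d) →L[ℝ] ℝ := EuclideanSpace.proj k with hP
  have h1 : LipschitzWith (‖P‖₊ * K) (fun t => f t k) := P.lipschitz.comp hf
  have h2 := h1.lipschitzOnWith (s := uIcc a b) |>.absolutelyContinuousOnInterval
    |>.integral_deriv_eq_sub
  have h3 : ∫ t in a..b, deriv f t k = (∫ t in a..b, deriv f t) k :=
    P.intervalIntegral_comp_comm (intervalIntegrable_deriv_of_lipschitzWith hf a b)
  rw [← h3, PiLp.sub_apply, ← h2]
  refine intervalIntegral.integral_congr_ae ?_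
  filter_upwards [hf.ae_differentiableAt_real] with t ht _
  exact (P.hasFDerivAt.comp_hasDerivAt t ht.hasDerivAt).deriv.symm

/-- Curves that follow the uncontrolled flow outside of some time windows, during which they stay
in `ω`, and that never meet, can be realized by an admissible control. -/
theorem exactlyControllable_of_curves {n : ℕ} (hv : IsAdmissibleVelocity v) (hω : IsOpen ω) {T : ℝ}
    (hT : 0 ≤ T) {X₀ X₁ : Fin n → EuclideanSpace ℝ (Fin d)}
    (x : Fin n → ℝ → EuclideanSpace ℝ (Fin d)) {K : Fin n → ℝ≥0}
    (hK : ∀ i, LipschitzOnWith (K i) (x i) (Icc 0 T))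
    (hne : ∀ i j, i ≠ j → ∀ t ∈ Icc 0 T, x i t ≠ x j t) (s s' : Fin n → ℝ)
    (hs : ∀ i, 0 ≤ s i) (hs' : ∀ i, s' i ≤ T)
    (hxω : ∀ i, ∀ t ∈ Icc (s i) (s' i), x i t ∈ ω)
    (hpre : ∀ i, ∀ t ∈ Icc 0 (s i), x i t = flow v t (X₀ i))
    (hpost : ∀ i, ∀ t ∈ Icc (s' i) T, x i t = flow v (t - T) (X₁ i)) :
    ExactlyControllable v ω X₀ X₁ T := by
  obtain ⟨M, hM, hb⟩ := hv.bounded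
  obtain ⟨L, hL⟩ := hv.lipschitz
  set y : Fin n → ℝ → EuclideanSpace ℝ (Fin d) := fun i => IccExtend hT ((Icc 0 T).domRestrict (x i))
    with hy
  have hyx : ∀ i, ∀ t ∈ Icc 0 T, y i t = x i t := fun i t ht => by
    simp only [hy]
    rw [IccExtend_of_mem _ _ ht, domRestrict_apply]
  have hyK : ∀ i, LipschitzWith (K i) (y i) := fun i => by
    have := (lipschitzOnWith_iff_restrict.1 (hK i)).comp (LipschitzWith.projIcc hT)
    rwa [mul_one] at this
  have hyc : ∀ i, Continuous (y i) := fun i => (hyK i).continuous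
  have hwin : ∀ i, ∀ t ∈ Icc (s i) (s' i), t ∈ Icc 0 T := fun i t ht =>
    ⟨(hs i).trans ht.1, ht.2.trans (hs' i)⟩
  -- The control that agent `i` needs along its own curve. Where `y i` is not differentiable `deriv`
  -- is `0`; this preserves bounds and measurability, and concerns only a null set of times.
  set w : Fin n → ℝ → EuclideanSpace ℝ (Fin d) := fun i =>
    (Ioo (s i) (s' i)).indicator (fun t => deriv (y i) t - v (y i t)) with hw
  have hwm : ∀ i, Measurable (w i) := fun i =>
    ((measurable_deriv _).sub (hL.continuous.comp (hyc i)).measurable).indicator measurableSet_Ioo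
  obtain ⟨C, hC0, hC⟩ : ∃ C : ℝ, 0 < C ∧ ∀ i t, ‖w i t‖ ≤ C := by
    refine ⟨(∑ i, (K i : ℝ)) + M, by positivity, fun i t => ?_⟩
    refine (norm_indicator_le_norm_self _ _).trans ((norm_sub_le _ _).trans ?_)
    refine add_le_add ((norm_deriv_le_of_lipschitz (hyK i)).trans ?_) (hb _)
    exact Finset.single_le_sum (f := fun i => (K i : ℝ)) (fun _ _ => NNReal.coe_nonneg _)
      (Finset.mem_univ i)
  have hsep : ∀ i j, i ≠ j → ∀ᶠ r in 𝓝[>] (0 : ℝ), ∀ t ∈ Icc 0 T, r ≤ ‖y i t - y j t‖ := by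
    intro i j hij
    obtain ⟨a, ha, ha'⟩ := isCompact_Icc.exists_forall_le' (a := (0 : ℝ)) (s := Icc 0 T)
      (f := fun t => ‖y i t - y j t‖) ((hyc i).sub (hyc j)).norm.continuousOn (fun t ht => by
        rw [norm_pos_iff, sub_ne_zero, hyx i t ht, hyx j t ht]
        exact hne i j hij t ht)
    filter_upwards [Ioo_mem_nhdsGT ha] with r hr t ht
    exact hr.2.le.trans (ha' t ht)
  have hthick : ∀ i, ∀ᶠ r in 𝓝[>] (0 : ℝ), Metric.thickening r (y i '' Icc (s i) (s' i)) ⊆ ω := by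
    intro i
    obtain ⟨a, ha, ha'⟩ := (isCompact_Icc.image (hyc i)).exists_thickening_subset_open hω
      (s := y i '' Icc (s i) (s' i)) (by
        rintro _ ⟨t, ht, rfl⟩
        rw [hyx i t (hwin i t ht)]
        exact hxω i t ht)
    filter_upwards [Ioo_mem_nhdsGT ha] with r hr
    exact (Metric.thickening_mono hr.2.le _).trans ha'
  -- By compactness one radius `r` both separates the curves at all times and keeps the
  -- `r`-neighbourhood of each window arc inside `ω`.
  obtain ⟨r, ⟨hr1, hr2⟩, hr0⟩ := (((Filter.eventually_all.2 fun i => Filter.eventually_all.2 fun j =>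
    Filter.eventually_all.2 (hsep i j)).and (Filter.eventually_all.2 hthick)).and
    self_mem_nhdsWithin).exists
  replace hr0 : 0 < r := hr0
  -- A tent of height `1` and radius `r`, Lipschitz with constant `r⁻¹`.
  set η : EuclideanSpace ℝ (Fin d) → ℝ := fun z => max 0 (1 - ‖z‖ / r) with hη
  have hη0 : η 0 = 1 := by simp [hη]
  have hηr : ∀ z, r ≤ ‖z‖ → η z = 0 := fun z hz => by
    simp only [hη]
    rw [max_eq_left]
    rw [sub_nonpos, one_le_div hr0]
    exact hz
  have hη01 : ∀ z, |η z| ≤ 1 := fun z => by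
    rw [abs_of_nonneg (le_max_left _ _)]
    have : 0 ≤ ‖z‖ / r := by positivity
    exact max_le zero_le_one (by linarith)
  have hηlip : ∀ z z', |η z - η z'| ≤ r⁻¹ * dist z z' := fun z z' => by
    simp only [hη]
    rw [max_comm 0, max_comm 0]
    refine (abs_max_sub_max_le_abs _ _ _).trans ?_
    rw [sub_sub_sub_cancel_left, ← sub_div, abs_div, abs_of_pos hr0, div_eq_inv_mul, dist_comm,
      dist_eq_norm]
    gcongr
    exact abs_norm_sub_norm_le _ _
  set u : EuclideanSpace ℝ (Fin d) → ℝ → EuclideanSpace ℝ (Fin d) := fun z t =>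
    ∑ i, η (z - y i t) • w i t with hu
  -- Every active bump is supported in `ω`, so cutting off by the indicator changes nothing and
  -- cannot spoil the Lipschitz bound.
  have hloc : ∀ z t, localizedControl ω u z t = u z t := fun z t => by
    rw [localizedControl, indicator_apply_eq_self]
    intro hz
    refine Finset.sum_eq_zero fun i _ => ?_
    by_cases ht : t ∈ Ioo (s i) (s' i)
    · rw [hηr, zero_smul]
      by_contra! hlt
      refine hz (hr2 i (Metric.mem_thickening_iff.2
        ⟨y i t, mem_image_of_mem _ (Ioo_subset_Icc_self ht), ?_⟩))
      rwa [dist_eq_norm]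
    · simp [hw, ht]
  have huy : ∀ i, ∀ t ∈ Icc 0 T, u (y i t) t = w i t := fun i t ht => by
    simp only [hu]
    rw [Finset.sum_eq_single i]
    · rw [sub_self, hη0, one_smul]
    · intro j _ hj
      rw [hηr _ (hr1 i j hj.symm t ht), zero_smul]
    · simp
  have hae : ∀ i, ∀ᵐ t ∂(volume : Measure ℝ), t ∈ uIoc 0 T →
      deriv (y i) t = v (x i t) + localizedControl ω u (x i t) t := by
    intro i
    have hne : ∀ a : ℝ, ∀ᵐ t ∂(volume : Measure ℝ), t ≠ a := fun a => by simp [ae_iff]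
    filter_upwards [hne (s i), hne (s' i), hne T] with t h1 h2 h3 ht
    rw [uIoc_of_le hT] at ht
    have htT : t ∈ Icc 0 T := Ioc_subset_Icc_self ht
    rw [hloc, ← hyx i t htT, huy i t htT]
    by_cases hmem : t ∈ Ioo (s i) (s' i)
    · simp [hw, hmem]
    simp only [hw, indicator_of_notMem hmem, add_zero]
    rcases lt_or_gt_of_ne h1 with h1 | h1
    · have : y i =ᶠ[𝓝 t] fun t => flow v t (X₀ i) := by
        filter_upwards [Ioo_mem_nhds ht.1 (lt_min h1 (lt_of_le_of_ne ht.2 h3))] with r hr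
        have hr' := lt_min_iff.1 hr.2
        rw [hyx i r ⟨hr.1.le, hr'.2.le⟩, hpre i r ⟨hr.1.le, hr'.1.le⟩]
      rw [this.deriv_eq, (hasDerivAt_flow hv _ t).deriv, this.eq_of_nhds]
    · have h2 : s' i < t := lt_of_le_of_ne (not_lt.1 fun h => hmem ⟨h1, h⟩) h2.symm
      have : y i =ᶠ[𝓝 t] fun t => flow v (t - T) (X₁ i) := by
        filter_upwards [Ioo_mem_nhds (max_lt h2 ht.1) (lt_of_le_of_ne ht.2 h3)] with r hr
        have hr' := max_lt_iff.1 hr.1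
        rw [hyx i r ⟨hr'.2.le, hr.2.le⟩, hpost i r ⟨hr'.1.le, hr.2.le⟩]
      rw [this.deriv_eq, ((hasDerivAt_flow hv _ (t - T)).comp_sub_const t T).deriv,
        this.eq_of_nhds]
  have hx0 : ∀ i, x i 0 = X₀ i := fun i => by
    rw [hpre i 0 ⟨le_rfl, hs i⟩, flow_zero hv]
  have hx1 : ∀ i, x i T = X₁ i := fun i => by
    rw [hpost i T ⟨hs' i, le_rfl⟩, sub_self, flow_zero hv]
  -- Each of the `n` bumps has height at most `C` and slope at most `C * r⁻¹`. The `+ 1` keeps the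
  -- bound positive when `n = 0`.
  refine ⟨u, ⟨⟨(⟨n * (C * r⁻¹), by positivity⟩ : ℝ≥0), fun t => ?_⟩, fun z => ?_, n * C + 1, by positivity,
    fun z t => ?_⟩, x, fun i => ⟨?_, fun t ht => ?_⟩, 1, fun i => hx1 i⟩
  · refine LipschitzWith.of_dist_le_mul fun z z' => ?_
    simp only [hloc]
    change dist (u z t) (u z' t) ≤ n * (C * r⁻¹) * dist z z'
    simp only [hu]
    rw [dist_eq_norm, ← Finset.sum_sub_distrib]
    calc ‖∑ i, (η (z - y i t) • w i t - η (z' - y i t) • w i t)‖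
        ≤ ∑ i : Fin n, C * r⁻¹ * dist z z' := norm_sum_le_of_le _ fun i _ => by
          rw [← sub_smul, norm_smul, Real.norm_eq_abs]
          calc _ ≤ (r⁻¹ * dist (z - y i t) (z' - y i t)) * C :=
                mul_le_mul (hηlip _ _) (hC i t) (norm_nonneg _) (by positivity)
            _ = _ := by rw [dist_sub_right]; ring
      _ = _ := by simp; ring
  · simp only [hloc]
    simp only [hu]
    refine Finset.measurable_fun_sum _ fun i _ => Measurable.smul (f := fun t => η (z - y i t)) ?_ (hwm i)
    simp only [hη]
    have := (continuous_const.sub (hyc i) : Continuous fun t => z - y i t)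
    fun_prop
  · rw [hloc]
    calc ‖u z t‖ ≤ ∑ i : Fin n, C := norm_sum_le_of_le _ fun i _ => by
          rw [norm_smul, Real.norm_eq_abs]
          exact (mul_le_mul (hη01 _) (hC i t) (norm_nonneg _) zero_le_one).trans (one_mul C).le
      _ ≤ _ := by simp
  · exact (intervalIntegrable_deriv_of_lipschitzWith (hyK i) 0 T).congr_ae
      ((ae_restrict_iff' measurableSet_uIoc).2 (hae i))
  · have h0 : (0 : ℝ) ∈ Icc 0 T := ⟨le_rfl, hT⟩
    rw [← intervalIntegral.integral_congr_ae (f := deriv (y i)),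
      integral_deriv_of_lipschitzWith (hyK i), hyx i t ht, hyx i 0 h0, hx0]
    · abel
    · filter_upwards [hae i] with r hr hr'
      refine hr ?_
      rw [uIoc_of_le ht.1] at hr'
      rw [uIoc_of_le hT]
      exact ⟨hr'.1, hr'.2.trans ht.2⟩

end CrowdControl

/-! ### Dimension at least two: avoiding obstacles of small Hausdorff dimension. -/

namespace CrowdControl

theorem _root_.LipschitzWith.ite_le {E : Type*} [PseudoMetricSpace E] {K K' : ℝ≥0} {f g : ℝ → E} {m : ℝ}
    (hf : LipschitzWith K f) (hg : LipschitzWith K' g) (h : f m = g m) :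
    LipschitzWith (max K K') (fun t => if t ≤ m then f t else g t) := by
  replace hf := hf.weaken (le_max_left K K')
  replace hg := hg.weaken (le_max_right K K')
  have key : ∀ s t, s ≤ m → m < t → dist (f s) (g t) ≤ (max K K' : ℝ≥0) * dist s t := by
    intro s t hs ht
    have h1 := hf.dist_le_mul s m
    have h2 := hg.dist_le_mul m t
    have h3 : dist s t = dist s m + dist m t := by
      rw [dist_comm s t, dist_comm s m, dist_comm m t, Real.dist_eq, Real.dist_eq, Real.dist_eq,
        abs_of_nonneg, abs_of_nonneg, abs_of_nonneg] <;> linarith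
    calc _ ≤ dist (f s) (f m) + dist (g m) (g t) := by
          rw [← h]; exact dist_triangle _ _ _
      _ ≤ _ := by rw [h3, mul_add]; exact add_le_add h1 h2
  refine LipschitzWith.of_dist_le_mul fun s t => ?_
  rcases le_or_gt s m with hs | hs <;> rcases le_or_gt t m with ht | ht
  · simpa only [hs, ht, if_true] using hf.dist_le_mul s t
  · simpa only [hs, ht.not_ge, if_true, if_false] using key s t hs ht
  · simpa only [ht, hs.not_ge, if_true, if_false, dist_comm] using key t s ht hs
  · simpa only [hs.not_ge, ht.not_ge, if_false] using hg.dist_le_mul s t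

theorem dimH_graphOn_le_one {E : Type*} [MetricSpace E] {K : ℝ≥0} {f : ℝ → E}
    (hf : LipschitzWith K f) (s : Set ℝ) : dimH ((fun t => (t, f t)) '' s) ≤ 1 := by
  refine ((LipschitzWith.id.prodMk hf).dimH_image_le s).trans ?_
  rw [← Real.dimH_univ]
  exact dimH_mono (subset_univ s)

variable {E : Type*} [NormedAddCommGroup E] [NormedSpace ℝ E]

theorem lipschitzWith_add_div_smul (p w : E) (a c : ℝ) :
    LipschitzWith (‖c⁻¹ • w‖₊) (fun t : ℝ => p + ((t - a) / c) • w) := by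
  refine LipschitzWith.of_dist_le_mul fun s t => ?_
  rw [dist_add_left, dist_eq_norm, ← sub_smul, ← sub_div, sub_sub_sub_cancel_right, div_eq_mul_inv,
    mul_smul, norm_smul, Real.dist_eq, coe_nnnorm, mul_comm, Real.norm_eq_abs]

variable [FiniteDimensional ℝ E]

/-- The positions at time `m` whose uniform motion from `p` at time `a` meets the obstacle `O`. -/
def blockedEndpoints (O : Set (ℝ × E)) (p : E) (a m : ℝ) : Set E :=
  {z | ∃ t, 0 < (t - a) / (m - a) ∧ (t, p + ((t - a) / (m - a)) • (z - p)) ∈ O}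

/-- An endpoint is recovered from the obstacle point it hits by the central projection `φ` from `p`.
This map is `C¹` on the half-space where the elapsed fraction of time is positive, and a `C¹` map on
a convex set does not raise Hausdorff dimension. -/
theorem dimH_blockedEndpoints_le (O : Set (ℝ × E)) (p : E) (a m : ℝ) :
    dimH (blockedEndpoints O p a m) ≤ dimH O := by
  set H : Set (ℝ × E) := {y | 0 < (y.1 - a) / (m - a)} with hH
  set φ : ℝ × E → E := fun y => p + ((y.1 - a) / (m - a))⁻¹ • (y.2 - p) with hφ
  have hconv : Convex ℝ H := by
    have : IsLinearMap ℝ (fun y : ℝ × E => y.1 / (m - a)) :=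
      ⟨fun x y => add_div _ _ _, fun c x => by simp [mul_div_assoc]⟩
    have e : H = {w | a / (m - a) < w.1 / (m - a)} := by
      ext y
      simp [hH, sub_div]
    rw [e]
    exact convex_halfSpace_gt this _
  have hsmooth : ContDiffOn ℝ 1 φ H := by
    refine contDiffOn_const.add (ContDiffOn.smul ?_ (contDiff_snd.contDiffOn.sub contDiffOn_const))
    refine ContDiffOn.inv ?_ fun y hy => ne_of_gt hy
    exact (contDiff_fst.contDiffOn.sub contDiffOn_const).div_const _
  have hsub : blockedEndpoints O p a m ⊆ φ '' (O ∩ H) := by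
    rintro z ⟨t, ht, hO⟩
    refine ⟨_, ⟨hO, ht⟩, ?_⟩
    simp only [hφ, add_sub_cancel_left]
    rw [inv_smul_smul₀ ht.ne', add_sub_cancel]
  calc _ ≤ dimH (φ '' (O ∩ H)) := dimH_mono hsub
    _ ≤ dimH (O ∩ H) := hsmooth.dimH_image_le hconv inter_subset_right
    _ ≤ _ := dimH_mono inter_subset_left

theorem exists_mem_notMem_of_dimH_lt {S U : Set E} (hS : dimH S < Module.finrank ℝ E)
    (hU : IsOpen U) (hne : U.Nonempty) : ∃ z ∈ U, z ∉ S := by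
  obtain ⟨z, hz, hz'⟩ := (dense_compl_of_dimH_lt_finrank hS).inter_open_nonempty U hU hne
  exact ⟨z, hz, hz'⟩

/-- `x` and `y` can be joined by a Lipschitz curve in `ω` during any time interval, avoiding any
small enough set of obstacles in space-time. -/
def AvoidablyJoined (ω : Set E) (x y : E) : Prop :=
  ∀ O : Set (ℝ × E), dimH O < Module.finrank ℝ E → ∀ a b : ℝ, a < b → (a, x) ∉ O → (b, y) ∉ O →
    ∃ (K : ℝ≥0) (γ : ℝ → E), LipschitzWith K γ ∧ γ a = x ∧ γ b = y ∧
      ∀ t ∈ Icc a b, γ t ∈ ω ∧ (t, γ t) ∉ O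

/-- Go straight from `x` to a midway point `z` and straight on to `y`. The bad choices of `z` form a
set of dimension less than that of `E`, so the open set `C` contains a good one. -/
theorem AvoidablyJoined.of_convex {ω C : Set E} (hC : IsOpen C) (hCc : Convex ℝ C) (hCω : C ⊆ ω)
    {x y : E} (hx : x ∈ C) (hy : y ∈ C) : AvoidablyJoined ω x y := by
  intro O hO a b hab ha hb
  set m := (a + b) / 2 with hm
  have ham : a < m := by linarith
  have hmb : m < b := by linarith
  obtain ⟨z, hz, hzO⟩ := exists_mem_notMem_of_dimH_lt
    (S := blockedEndpoints O x a m ∪ blockedEndpoints O y b m)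
    (by
      rw [dimH_union]
      exact (max_le (dimH_blockedEndpoints_le _ _ _ _) (dimH_blockedEndpoints_le _ _ _ _)).trans_lt
        hO) hC ⟨x, hx⟩
  rw [mem_union, not_or] at hzO
  have e1 : (m - a) / (m - a) = 1 := div_self (by linarith)
  have e2 : (m - b) / (m - b) = 1 := div_self (by linarith)
  refine ⟨_, fun t => if t ≤ m then x + ((t - a) / (m - a)) • (z - x)
    else y + ((t - b) / (m - b)) • (z - y), LipschitzWith.ite_le
      (lipschitzWith_add_div_smul _ _ _ _) (lipschitzWith_add_div_smul _ _ _ _) ?_, ?_, ?_, ?_⟩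
  · simp only [e1, e2, one_smul, add_sub_cancel]
  · simp [ham.le]
  · simp [hmb]
  · intro t ht
    rcases le_or_gt t m with htm | htm
    · simp only [htm, if_true]
      refine ⟨hCω (hCc.add_smul_sub_mem hx hz ⟨div_nonneg ?_ ?_, ?_⟩), ?_⟩
      · linarith [ht.1]
      · linarith
      · rw [div_le_one] <;> linarith
      -- At time `a` the motion is at `x` for every `z`, so that instant is covered by `ha`, not by
      -- the choice of `z`.
      · rcases ht.1.eq_or_lt with rfl | hat
        · simpa using ha
        · exact fun h => hzO.1 ⟨t, div_pos (by linarith) (by linarith), h⟩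
    · simp only [htm.not_ge, if_false]
      refine ⟨hCω (hCc.add_smul_sub_mem hy hz ⟨div_nonneg_of_nonpos ?_ ?_, ?_⟩), ?_⟩
      · linarith [ht.2]
      · linarith
      · rw [div_le_one_of_neg] <;> linarith
      · rcases ht.2.eq_or_lt with rfl | htb
        · simpa using hb
        · exact fun h => hzO.2 ⟨t, div_pos_of_neg_of_neg (by linarith) (by linarith), h⟩

/-- Being joinable is a local property by convexity of balls, and connectedness propagates it. The
relation is required on whole balls because, for transitivity, the intermediate point must be moved
off the obstacle at time `m`. -/
theorem AvoidablyJoined.of_isPreconnected {ω : Set E} (hω : IsOpen ω) (hc : IsPreconnected ω)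
    {x y : E} (hx : x ∈ ω) (hy : y ∈ ω) : AvoidablyJoined ω x y := by
  suffices h : ∃ ε > 0, ∀ x' ∈ Metric.ball x ε, ∀ y' ∈ Metric.ball y ε, AvoidablyJoined ω x' y' by
    obtain ⟨ε, hε, h⟩ := h
    exact h x (Metric.mem_ball_self hε) y (Metric.mem_ball_self hε)
  refine hc.induction₂' (fun x y => ∃ ε > 0, ∀ x' ∈ Metric.ball x ε, ∀ y' ∈ Metric.ball y ε,
    AvoidablyJoined ω x' y') (fun x hx => ?_) ?_ hx hy
  · obtain ⟨r, hr, hrω⟩ := Metric.isOpen_iff.1 hω x hx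
    have hloc : ∀ y ∈ Metric.ball x (r / 2), ∀ y' ∈ Metric.ball y (r / 2), y' ∈ Metric.ball x r := by
      intro y hy y' hy'
      rw [Metric.mem_ball] at *
      linarith [dist_triangle y' y x]
    have hx' : x ∈ Metric.ball x (r / 2) := Metric.mem_ball_self (by positivity)
    filter_upwards [nhdsWithin_le_nhds (Metric.ball_mem_nhds x (half_pos hr))] with y hy
    exact ⟨⟨r / 2, half_pos hr, fun x' hx'' y' hy' => of_convex Metric.isOpen_ball
        (convex_ball x r) hrω (hloc x hx' x' hx'') (hloc y hy y' hy')⟩,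
      ⟨r / 2, half_pos hr, fun y' hy' x' hx'' => of_convex Metric.isOpen_ball
        (convex_ball x r) hrω (hloc y hy y' hy') (hloc x hx' x' hx'')⟩⟩
  · rintro x y z - - - ⟨ε, hε, h⟩ ⟨δ, hδ, h'⟩
    refine ⟨min ε δ, lt_min hε hδ, fun x' hx' z' hz' O hO a b hab ha hb => ?_⟩
    set m := (a + b) / 2 with hm
    have ham : a < m := by linarith
    have hmb : m < b := by linarith
    obtain ⟨y', hy', hyO⟩ := exists_mem_notMem_of_dimH_lt (S := Prod.snd '' O)
      ((LipschitzWith.prod_snd.dimH_image_le O).trans_lt hO) (Metric.isOpen_ball (x := y))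
      ⟨y, Metric.mem_ball_self (lt_min hε hδ)⟩
    replace hyO : (m, y') ∉ O := fun h => hyO ⟨_, h, rfl⟩
    obtain ⟨K, γ, hγ, hγa, hγm, hγO⟩ := h x' (Metric.ball_subset_ball (min_le_left _ _) hx') y'
      (Metric.ball_subset_ball (min_le_left _ _) hy') O hO a m ham ha hyO
    obtain ⟨K', γ', hγ', hγm', hγb', hγO'⟩ := h' y' (Metric.ball_subset_ball (min_le_right _ _) hy')
      z' (Metric.ball_subset_ball (min_le_right _ _) hz') O hO m b hmb hyO hb
    refine ⟨_, _, LipschitzWith.ite_le hγ hγ' (hγm.trans hγm'.symm), ?_, ?_, fun t ht => ?_⟩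
    · simp [ham.le, hγa]
    · simp [hmb, hγb']
    · rcases le_or_gt t m with htm | htm
      · simpa only [htm, if_true] using hγO t ⟨ht.1, htm⟩
      · simpa only [htm.not_ge, if_false] using hγO' t ⟨htm.le, ht.2⟩

/-- Curves in a connected open set of dimension at least two with prescribed endpoints can be chosen
one after the other so that they avoid each other and the given obstacles. -/
theorem exists_disjoint_curves {ι : Type*} [Finite ι] {ω : Set E} (hω : IsOpen ω)
    (hc : IsPreconnected ω) (hE : 1 < Module.finrank ℝ E) (F : ι → Set (ℝ × E))
    (hF : ∀ i, dimH (F i) ≤ 1) (hdisj : ∀ i j, i ≠ j → Disjoint (F i) (F j)) {s s' : ι → ℝ}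
    (hs : ∀ i, s i < s' i) {p q : ι → E} (hp : ∀ i, p i ∈ ω) (hq : ∀ i, q i ∈ ω)
    (hpF : ∀ i, (s i, p i) ∈ F i) (hqF : ∀ i, (s' i, q i) ∈ F i) :
    ∃ (K : ι → ℝ≥0) (γ : ι → ℝ → E), ∀ i, LipschitzWith (K i) (γ i) ∧ γ i (s i) = p i ∧
      γ i (s' i) = q i ∧ ∀ t ∈ Icc (s i) (s' i), γ i t ∈ ω ∧ ∀ j, i ≠ j → (t, γ i t) ∉ F j ∧
        (t ∈ Icc (s j) (s' j) → γ i t ≠ γ j t) := by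
  classical
  cases nonempty_fintype ι
  suffices h : ∀ S : Finset ι, ∃ (K : ι → ℝ≥0) (γ : ι → ℝ → E), ∀ i ∈ S,
      LipschitzWith (K i) (γ i) ∧ γ i (s i) = p i ∧
      γ i (s' i) = q i ∧ ∀ t ∈ Icc (s i) (s' i), γ i t ∈ ω ∧ ∀ j, i ≠ j → (t, γ i t) ∉ F j ∧
        (j ∈ S → t ∈ Icc (s j) (s' j) → γ i t ≠ γ j t) by
    obtain ⟨K, γ, h⟩ := h Finset.univ
    exact ⟨K, γ, fun i => by simpa using h i (Finset.mem_univ i)⟩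
  intro S
  induction S using Finset.induction_on with
  | empty => exact ⟨0, 0, by simp⟩
  | insert i S hi ih =>
    obtain ⟨K, γ, h⟩ := ih
    set O : Set (ℝ × E) := (⋃ j : {j // j ≠ i}, F j) ∪
      ⋃ j : S, (fun t => (t, γ j t)) '' Icc (s j) (s' j) with hO
    have hOdim : dimH O < Module.finrank ℝ E := by
      refine lt_of_le_of_lt (b := 1) ?_ (by exact_mod_cast hE)
      rw [hO, dimH_union, dimH_iUnion, dimH_iUnion]
      exact max_le (iSup_le fun j => hF j) (iSup_le fun j => dimH_graphOn_le_one (h j j.2).1 _)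
    have hFO : ∀ y ∈ F i, (∀ j ∈ S, y ∉ (fun t => (t, γ j t)) '' Icc (s j) (s' j)) := by
      rintro y hy j hj ⟨t, ht, rfl⟩
      exact (((h j hj).2.2.2 t ht).2 i (fun e => hi (e ▸ hj))).1 hy
    have hFO' : ∀ y ∈ F i, y ∉ O := by
      rintro y hy (hy' | hy')
      · obtain ⟨j, hj⟩ := mem_iUnion.1 hy'
        exact disjoint_left.1 (hdisj j i j.2) hj hy
      · obtain ⟨j, hj⟩ := mem_iUnion.1 hy'
        exact hFO y hy j j.2 hj
    obtain ⟨L, g, hg, hgs, hgs', hgO⟩ := AvoidablyJoined.of_isPreconnected hω hc (hp i) (hq i) O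
      hOdim (s i) (s' i) (hs i) (hFO' _ (hpF i)) (hFO' _ (hqF i))
    refine ⟨Function.update K i L, Function.update γ i g, fun k hk => ?_⟩
    rcases Finset.mem_insert.1 hk with rfl | hkS
    · simp only [Function.update_self]
      refine ⟨hg, hgs, hgs', fun t ht => ⟨(hgO t ht).1, fun j hj => ⟨fun hmem => ?_, ?_⟩⟩⟩
      · exact (hgO t ht).2 (Or.inl (mem_iUnion.2 ⟨⟨j, hj.symm⟩, hmem⟩))
      · rw [Function.update_of_ne hj.symm]
        intro hjS htj heq
        have hjS' := Finset.mem_of_mem_insert_of_ne hjS hj.symm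
        exact (hgO t ht).2 (Or.inr (mem_iUnion.2 ⟨⟨j, hjS'⟩, t, htj, by rw [heq]⟩))
    · have hki : k ≠ i := fun e => hi (e ▸ hkS)
      obtain ⟨h1, h2, h3, h4⟩ := h k hkS
      simp only [Function.update_of_ne hki]
      refine ⟨h1, h2, h3, fun t ht => ⟨(h4 t ht).1, fun j hj => ⟨((h4 t ht).2 j hj).1, ?_⟩⟩⟩
      intro hjS htj
      by_cases hji : j = i
      · subst hji
        rw [Function.update_self]
        intro heq
        exact (hgO t htj).2 (Or.inr (mem_iUnion.2 ⟨⟨k, hkS⟩, t, ht, Prod.ext rfl heq⟩))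
      · rw [Function.update_of_ne hji]
        exact ((h4 t ht).2 j hj).2 (Finset.mem_of_mem_insert_of_ne hjS hji) htj

end CrowdControl

/-! ### Control windows, and steering in dimension at least two. -/

namespace CrowdControl

variable {d : ℕ} {v : EuclideanSpace ℝ (Fin d) → EuclideanSpace ℝ (Fin d)}
  {ω : Set (EuclideanSpace ℝ (Fin d))}

theorem backwardEntryTime_nonneg (hv : IsAdmissibleVelocity v) (x : EuclideanSpace ℝ (Fin d)) :
    0 ≤ backwardEntryTime v ω x := by
  rw [backwardEntryTime_eq hv]
  exact entryTime_nonneg x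

/-- Time windows for the control of each agent that are almost maximal. -/
theorem exists_windows {n : ℕ} (hv : IsAdmissibleVelocity v) {T : ℝ}
    {X₀ X₁ : Fin n → EuclideanSpace ℝ (Fin d)}
    (hX₀ : ∀ i, Reaches v ω (X₀ i)) (hX₁ : ∀ i, Reaches (-v) ω (X₁ i))
    (h : ∀ i, entryTime v ω (X₀ i) + backwardEntryTime v ω (X₁ i) < T) :
    ∃ s s' : Fin n → ℝ, (∀ i, 0 ≤ s i) ∧ (∀ i, s i < s' i) ∧ (∀ i, s' i ≤ T) ∧
      (∀ i, flow v (s i) (X₀ i) ∈ ω) ∧ (∀ i, flow v (s' i - T) (X₁ i) ∈ ω) ∧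
      ∀ i j, s' j ≤ s i → T ≤ entryTime v ω (X₀ i) + backwardEntryTime v ω (X₁ j) := by
  -- With `2 * ε` below every positive gap `T - (t⁰_i + t¹_j)`, windows opened and closed within `ε`
  -- of the extreme times are nonempty, and `s' j ≤ s i` forces that gap to be nonpositive.
  have hε : ∀ i j, ∀ᶠ ε in 𝓝[>] (0 : ℝ),
      entryTime v ω (X₀ i) + backwardEntryTime v ω (X₁ j) < T →
      entryTime v ω (X₀ i) + backwardEntryTime v ω (X₁ j) + 2 * ε < T := by
    intro i j
    by_cases hlt : entryTime v ω (X₀ i) + backwardEntryTime v ω (X₁ j) < T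
    · filter_upwards [Ioo_mem_nhdsGT (half_pos (sub_pos.2 hlt))] with ε hε _
      linarith [hε.2]
    · exact Filter.Eventually.of_forall fun _ h => absurd h hlt
  obtain ⟨ε, hε, hε0⟩ := ((Filter.eventually_all.2 fun i => Filter.eventually_all.2 (hε i)).and
    self_mem_nhdsWithin).exists
  replace hε0 : 0 < ε := hε0
  choose s hs0 hs hsω using fun i => (hX₀ i).exists_lt (lt_add_of_pos_right _ hε0)
  choose r hr0 hr hrω using fun i => (hX₁ i).exists_lt (lt_add_of_pos_right _ hε0)
  simp only [← backwardEntryTime_eq hv] at hr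
  refine ⟨s, fun i => T - r i, hs0, fun i => ?_, fun i => by linarith [hr0 i], hsω, fun i => ?_,
    fun i j hij => ?_⟩
  · linarith [hε i i (h i), hs i, hr i]
  · simpa [flow_neg hv] using hrω i
  · by_contra! hlt
    linarith [hε i j hlt, hs i, hr j]

/-- In dimension at least two, the agents can be steered in a prescribed pairing within any time that
is larger than all the uncontrollable times. -/
theorem exactlyControllable_of_two_le {n : ℕ} (hd : 2 ≤ d) (hv : IsAdmissibleVelocity v)
    (hω : IsOpen ω) (hc : IsPreconnected ω) {T : ℝ} (hT : 0 ≤ T)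
    {X₀ X₁ : Fin n → EuclideanSpace ℝ (Fin d)} (hd₀ : IsDisjoint X₀) (hd₁ : IsDisjoint X₁)
    (hX₀ : ∀ i, Reaches v ω (X₀ i)) (hX₁ : ∀ i, Reaches (-v) ω (X₁ i))
    (h : ∀ i, entryTime v ω (X₀ i) + backwardEntryTime v ω (X₁ i) < T) :
    ExactlyControllable v ω X₀ X₁ T := by
  obtain ⟨s, s', hs0, hss', hs'T, hsω, hs'ω, hov⟩ := exists_windows hv hX₀ hX₁ h
  obtain ⟨L, hL⟩ := exists_lipschitzWith_flow hv
  set pre : Fin n → ℝ → EuclideanSpace ℝ (Fin d) := fun i t => flow v t (X₀ i) with hpre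
  set post : Fin n → ℝ → EuclideanSpace ℝ (Fin d) := fun i t => flow v (t - T) (X₁ i) with hpost
  have hpreL : ∀ i, LipschitzWith L (pre i) := fun i => hL (X₀ i)
  have hpostL : ∀ i, LipschitzWith L (post i) := fun i => by
    have := (hL (X₁ i)).comp (LipschitzWith.of_le_add fun s t => by
      rw [Real.dist_eq]; linarith [le_abs_self (s - t)] : LipschitzWith 1 (fun t : ℝ => t - T))
    rwa [mul_one] at this
  have hprepost : ∀ i j, i ≠ j → ∀ t, t ≤ s i → s' j ≤ t → pre i t ≠ post j t := by
    -- If the free start of `i` met the free end of `j`, the free flow would carry `X₀ i` to `X₁ j`,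
    -- so `t⁰_i + t¹_j < T`, against `hov`.
    intro i j hij t hti htj heq
    have h1 := hov i j (htj.trans hti)
    have h2 : flow v T (X₀ i) = X₁ j := by
      have := congrArg (flow v (T - t)) heq
      simp only [hpre, hpost] at this
      rwa [← flow_add hv, ← flow_add hv, sub_add_cancel, sub_add_sub_cancel, sub_self,
        flow_zero hv] at this
    have h3 := entryTime_add_backwardEntryTime_lt hv hω (hX₀ i) h2
      (by linarith [h i, backwardEntryTime_nonneg hv (ω := ω) (X₁ i)])
    linarith
  set F : Fin n → Set (ℝ × EuclideanSpace ℝ (Fin d)) := fun i =>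
    (fun t => (t, pre i t)) '' Iic (s i) ∪ (fun t => (t, post i t)) '' Ici (s' i) with hF
  have hFdim : ∀ i, dimH (F i) ≤ 1 := fun i => by
    simp only [hF]
    rw [dimH_union]
    exact max_le (dimH_graphOn_le_one (hpreL i) _) (dimH_graphOn_le_one (hpostL i) _)
  have hFdisj : ∀ i j, i ≠ j → Disjoint (F i) (F j) := by
    intro i j hij
    rw [disjoint_left]
    rintro _ (⟨t, ht, rfl⟩ | ⟨t, ht, rfl⟩) (⟨t', ht', he⟩ | ⟨t', ht', he⟩) <;>
    obtain ⟨rfl, he⟩ := Prod.ext_iff.1 he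
    · exact hd₀ j i hij.symm (flow_injective hv _ he)
    · exact hprepost i j hij _ ht ht' he.symm
    · exact hprepost j i hij.symm _ ht' ht he
    · exact hd₁ j i hij.symm (flow_injective hv _ he)
  obtain ⟨K, γ, hγ⟩ := exists_disjoint_curves hω hc (by rwa [finrank_euclideanSpace_fin]) F hFdim hFdisj hss'
    (p := fun i => pre i (s i)) (q := fun i => post i (s' i)) hsω hs'ω
    (fun i => Or.inl ⟨s i, self_mem_Iic, rfl⟩) (fun i => Or.inr ⟨s' i, self_mem_Ici, rfl⟩)
  set x : Fin n → ℝ → EuclideanSpace ℝ (Fin d) := fun i t =>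
    if t ≤ s i then pre i t else if t ≤ s' i then γ i t else post i t with hx
  have hxL : ∀ i, LipschitzWith (max L (max (K i) L)) (x i) := fun i =>
    (hpreL i).ite_le ((hγ i).1.ite_le (hpostL i) (hγ i).2.2.1) (by
      simp only [(hss' i).le, if_true, (hγ i).2.1])
  have hxpre : ∀ i t, t ≤ s i → x i t = pre i t := fun i t ht => by simp only [hx, ht, if_true]
  have hxγ : ∀ i, ∀ t ∈ Icc (s i) (s' i), x i t = γ i t := fun i t ht => by
    rcases ht.1.eq_or_lt with rfl | hlt
    · rw [hxpre i _ le_rfl, (hγ i).2.1]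
    · simp only [hx, hlt.not_ge, ht.2, if_true, if_false]
  have hxpost : ∀ i t, s' i ≤ t → x i t = post i t := fun i t ht => by
    rcases ht.eq_or_lt with rfl | hlt
    · rw [hxγ i _ ⟨(hss' i).le, le_rfl⟩, (hγ i).2.2.1]
    · simp only [hx, hlt.not_ge, ((hss' i).trans hlt).not_ge, if_false]
  have hxcases : ∀ i t, (t, x i t) ∈ F i ∨ (t ∈ Icc (s i) (s' i) ∧ x i t = γ i t) := by
    intro i t
    rcases le_total t (s i) with h1 | h1
    · exact Or.inl (Or.inl ⟨t, h1, by rw [hxpre i t h1]⟩)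
    rcases le_total t (s' i) with h2 | h2
    · exact Or.inr ⟨⟨h1, h2⟩, hxγ i t ⟨h1, h2⟩⟩
    · exact Or.inl (Or.inr ⟨t, h2, by rw [hxpost i t h2]⟩)
  refine exactlyControllable_of_curves hv hω hT x (fun i => (hxL i).lipschitzOnWith)
    (fun i j hij t _ heq => ?_) s s' hs0 hs'T (fun i t ht => ?_) (fun i t ht => hxpre i t ht.2)
    (fun i t ht => hxpost i t ht.1)
  · rcases hxcases i t with h1 | ⟨h1, e1⟩ <;> rcases hxcases j t with h2 | ⟨h2, e2⟩
    · exact disjoint_left.1 (hFdisj i j hij) h1 (heq ▸ h2)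
    · exact (((hγ j).2.2.2 t h2).2 i hij.symm).1 (by rwa [← e2, ← heq])
    · exact (((hγ i).2.2.2 t h1).2 j hij).1 (by rwa [← e1, heq])
    · exact (((hγ i).2.2.2 t h1).2 j hij).2 h2 (by rw [← e1, ← e2, heq])
  · rw [hxγ i t ht]
    exact ((hγ i).2.2.2 t ht).1

end CrowdControl

namespace CrowdControl

variable {d : ℕ} {v : EuclideanSpace ℝ (Fin d) → EuclideanSpace ℝ (Fin d)}
  {ω : Set (EuclideanSpace ℝ (Fin d))}

/-! ### The flow on a line, read in a linear coordinate `e` -/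

/-- To change order, two trajectories would have to coincide at some instant, contrary to
injectivity of the flow. -/
theorem flow_strictMono (hv : IsAdmissibleVelocity v) (e : EuclideanSpace ℝ (Fin d) ≃L[ℝ] ℝ)
    {x y : EuclideanSpace ℝ (Fin d)} (h : e x < e y) (t : ℝ) : e (flow v t x) < e (flow v t y) := by
  by_contra! hle
  have hc : Continuous fun s => e (flow v s y) - e (flow v s x) :=
    (e.continuous.comp (continuous_flow hv y)).sub (e.continuous.comp (continuous_flow hv x))
  obtain ⟨s, hs⟩ := mem_range_of_exists_le_of_exists_ge hc (c := 0) ⟨t, by simpa using hle⟩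
    ⟨0, by simpa [flow_zero hv] using h.le⟩
  have := flow_injective hv s (e.injective (sub_eq_zero.1 hs))
  exact h.ne' (congrArg e this)

theorem flow_eq_self_of_eq_zero (hv : IsAdmissibleVelocity v) {x : EuclideanSpace ℝ (Fin d)}
    (hx : v x = 0) (t : ℝ) : flow v t x = x :=
  flow_unique hv (γ := fun _ => x) (fun t => by simpa [hx] using hasDerivAt_const t x) t

/-- Along a trajectory the scalar velocity either vanishes somewhere, and then the trajectory rests
at an equilibrium, or keeps its sign. -/
theorem flow_monotone_or_antitone (hv : IsAdmissibleVelocity v)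
    (e : EuclideanSpace ℝ (Fin d) ≃L[ℝ] ℝ) (x : EuclideanSpace ℝ (Fin d)) :
    Monotone (fun t => e (flow v t x)) ∨ Antitone (fun t => e (flow v t x)) := by
  obtain ⟨L, hL⟩ := hv.lipschitz
  have hd : ∀ t, HasDerivAt (fun t => e (flow v t x)) (e (v (flow v t x))) t := fun t =>
    e.hasFDerivAt.comp_hasDerivAt t (hasDerivAt_flow hv x t)
  have hdiff : Differentiable ℝ fun t => e (flow v t x) := fun t => (hd t).differentiableAt
  by_cases h0 : ∃ t, e (v (flow v t x)) = 0
  · obtain ⟨t, ht⟩ := h0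
    have ht' : v (flow v t x) = 0 := e.injective (by rw [ht, map_zero])
    have hconst : ∀ s, flow v s x = flow v t x := fun s => by
      rw [← flow_eq_self_of_eq_zero hv ht' (s - t), ← flow_add hv, sub_add_cancel]
    left
    intro r s _
    simp only [hconst r, hconst s, le_refl]
  · have hc : Continuous fun t => e (v (flow v t x)) :=
      e.continuous.comp (hL.continuous.comp (continuous_flow hv x))
    by_cases hpos : ∀ t, 0 ≤ e (v (flow v t x))
    · exact Or.inl (monotone_of_deriv_nonneg hdiff fun t => by rw [(hd t).deriv]; exact hpos t)
    · push Not at hpos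
      obtain ⟨t, ht⟩ := hpos
      refine Or.inr (antitone_of_deriv_nonpos hdiff fun s => ?_)
      rw [(hd s).deriv]
      by_contra! hs
      exact h0 (mem_range_of_exists_le_of_exists_ge hc ⟨t, ht.le⟩ ⟨s, hs.le⟩)

/-- The point `x` lies below the set `ω` in the coordinate `e`. -/
def Below (e : EuclideanSpace ℝ (Fin d) ≃L[ℝ] ℝ) (ω : Set (EuclideanSpace ℝ (Fin d)))
    (x : EuclideanSpace ℝ (Fin d)) : Prop :=
  ∀ w ∈ ω, e x < e w

/-- The opposite coordinate. -/
noncomputable def flipCoord (e : EuclideanSpace ℝ (Fin d) ≃L[ℝ] ℝ) :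
    EuclideanSpace ℝ (Fin d) ≃L[ℝ] ℝ :=
  e.trans (ContinuousLinearEquiv.neg ℝ)

@[simp]
theorem flipCoord_apply (e : EuclideanSpace ℝ (Fin d) ≃L[ℝ] ℝ) (x : EuclideanSpace ℝ (Fin d)) :
    flipCoord e x = -e x := rfl

variable {e : EuclideanSpace ℝ (Fin d) ≃L[ℝ] ℝ}

theorem ordConnected_image (hc : IsPreconnected ω) : (e '' ω).OrdConnected :=
  (hc.image e e.continuous.continuousOn).ordConnected

theorem mem_of_le_of_le (hc : IsPreconnected ω) {w w' x : EuclideanSpace ℝ (Fin d)} (hw : w ∈ ω)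
    (hw' : w' ∈ ω) (h : e w ≤ e x) (h' : e x ≤ e w') : x ∈ ω := by
  obtain ⟨z, hz, hzx⟩ := (ordConnected_image (e := e) hc).out (mem_image_of_mem e hw)
    (mem_image_of_mem e hw') ⟨h, h'⟩
  rwa [← e.injective hzx]

theorem below_or_below_of_notMem (hc : IsPreconnected ω) {x : EuclideanSpace ℝ (Fin d)}
    (hx : x ∉ ω) : Below e ω x ∨ Below (flipCoord e) ω x := by
  by_contra! h
  simp only [Below, flipCoord_apply] at h
  push Not at h
  obtain ⟨⟨w, hw, h1⟩, w', hw', h2⟩ := h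
  exact hx (mem_of_le_of_le hc hw hw' h1 (by linarith))

theorem Below.exists_flow_eq (hv : IsAdmissibleVelocity v) {x y : EuclideanSpace ℝ (Fin d)}
    (hy : Below e ω y) (hxy : e x ≤ e y) {s : ℝ} (hs : 0 ≤ s) (hω : flow v s x ∈ ω) :
    ∃ r ∈ Icc 0 s, flow v r x = y := by
  have hc : Continuous fun r => e (flow v r x) := e.continuous.comp (continuous_flow hv x)
  obtain ⟨r, hr, hr'⟩ := intermediate_value_Icc hs hc.continuousOn (show e y ∈ _ from
    ⟨by simpa [flow_zero hv] using hxy, (hy _ hω).le⟩)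
  exact ⟨r, hr, e.injective hr'⟩

theorem Below.monotone_flow (hv : IsAdmissibleVelocity v) {x : EuclideanSpace ℝ (Fin d)}
    {r s : ℝ} (hx : Below e ω (flow v r x)) (hrs : r ≤ s) (hω : flow v s x ∈ ω) :
    Monotone (fun t => e (flow v t x)) :=
  (flow_monotone_or_antitone hv e x).resolve_right fun h => (hx _ hω).not_ge (h hrs)

theorem Below.antitone_flow (hv : IsAdmissibleVelocity v) {x : EuclideanSpace ℝ (Fin d)}
    {r s : ℝ} (hx : Below e ω (flow v r x)) (hrs : s ≤ r) (hω : flow v s x ∈ ω) :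
    Antitone (fun t => e (flow v t x)) :=
  (flow_monotone_or_antitone hv e x).resolve_left fun h => (hx _ hω).not_ge (h hrs)

/-- If `x` is the lower point, it passes through `y` on its way up to `ω`; by monotonicity the past
of `y` is lower still, so it misses `ω`. If `y` is lower, the same argument applies to `-v`. -/
theorem Below.not_reaches_neg (hv : IsAdmissibleVelocity v) {x y : EuclideanSpace ℝ (Fin d)}
    (hx : Below e ω x) (hxω : Reaches v ω x) (hy : Below e ω y) : ¬ Reaches (-v) ω y := by
  have key : ∀ (v : EuclideanSpace ℝ (Fin d) → EuclideanSpace ℝ (Fin d)),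
      IsAdmissibleVelocity v → ∀ x y, Below e ω x → Below e ω y → e x ≤ e y → Reaches v ω x →
      Reaches (-v) ω y → False := by
    rintro v hv x y hx hy hxy ⟨s, hs, hsω⟩ ⟨r, hr, hrω⟩
    obtain ⟨q, hq, rfl⟩ := hy.exists_flow_eq hv hxy hs.le hsω
    rw [← flow_zero hv x] at hx
    have h1 := hx.monotone_flow hv hs.le hsω
    rw [flow_neg hv, ← flow_add hv] at hrω
    exact (hy _ hrω).not_ge (h1 (by linarith))
  intro hyω
  rcases le_total (e x) (e y) with h | h
  · exact key v hv x y hx hy h hxω hyω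
  · exact key (-v) hv.neg y x hy hx h hyω (by rwa [neg_neg])

/-- If `y` is below `ω`, the trajectory of `x` passes through `y` before entering, so `x` needs at
least as long. -/
theorem entryTime_le_of_le (hv : IsAdmissibleVelocity v) {x y : EuclideanSpace ℝ (Fin d)}
    (hxy : e x ≤ e y) (hx : Reaches v ω x) (hy : y ∈ ω ∨ Below e ω y) :
    entryTime v ω y ≤ entryTime v ω x := by
  rcases hy with hy | hy
  · rw [entryTime_eq_zero hv hy]
    exact entryTime_nonneg x
  · by_contra! hlt
    obtain ⟨s, hs0, hs, hsω⟩ := hx.exists_lt hlt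
    obtain ⟨r, hr, rfl⟩ := hy.exists_flow_eq hv hxy hs0 hsω
    have := entryTime_le (v := v) (ω := ω) (x := flow v r x) (t := s - r) (by linarith [hr.2])
      (by rwa [← flow_add hv, sub_add_cancel])
    linarith [hr.1]

variable {n : ℕ} {X₀ X₁ : Fin n → EuclideanSpace ℝ (Fin d)} {T : ℝ}

/-- Agents come in on one side of `ω` and leave on the other: one start below excludes targets
below, and then one target above excludes starts above. On a single side, entry times are monotone
in position. -/
theorem entryTimes_ordered_of_below (hv : IsAdmissibleVelocity v) (hc : IsPreconnected ω)
    (hX₀ : ∀ i, Reaches v ω (X₀ i)) (hX₁ : ∀ i, Reaches (-v) ω (X₁ i)) {i₀ j₀ : Fin n}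
    (hi₀ : Below e ω (X₀ i₀)) (hj₀ : X₁ j₀ ∉ ω) :
    (∀ i j, e (X₀ i) ≤ e (X₀ j) → entryTime v ω (X₀ j) ≤ entryTime v ω (X₀ i)) ∧
    ∀ i j, e (X₁ i) ≤ e (X₁ j) → backwardEntryTime v ω (X₁ i) ≤ backwardEntryTime v ω (X₁ j) := by
  have h1 : ∀ j, ¬ Below e ω (X₁ j) := fun j h => hi₀.not_reaches_neg hv (hX₀ i₀) h (hX₁ j)
  have h2 := (below_or_below_of_notMem hc hj₀).resolve_left (h1 j₀)
  have h3 : ∀ i, ¬ Below (flipCoord e) ω (X₀ i) := fun i h =>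
    h.not_reaches_neg hv (hX₀ i) h2 (hX₁ j₀)
  refine ⟨fun i j hij => entryTime_le_of_le hv hij (hX₀ i) ?_, fun i j hij => ?_⟩
  · exact or_iff_not_imp_left.2 fun h => (below_or_below_of_notMem hc h).resolve_right (h3 j)
  · rw [backwardEntryTime_eq hv, backwardEntryTime_eq hv]
    refine entryTime_le_of_le (e := flipCoord e) hv.neg (by simpa using hij) (hX₁ j) ?_
    exact or_iff_not_imp_left.2 fun h => (below_or_below_of_notMem hc h).resolve_left (h1 i)

/-- On a line, the order preserving pairing is optimal. -/
theorem add_lt_of_strictMono (hv : IsAdmissibleVelocity v) (hc : IsPreconnected ω)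
    (hX₀ : ∀ i, Reaches v ω (X₀ i)) (hX₁ : ∀ i, Reaches (-v) ω (X₁ i))
    (he₀ : StrictMono (fun i => e (X₀ i))) (he₁ : StrictMono (fun i => e (X₁ i)))
    (σ τ : Equiv.Perm (Fin n))
    (h : ∀ k, entryTime v ω (X₀ (σ k)) + backwardEntryTime v ω (X₁ (τ k)) < T) (i : Fin n) :
    entryTime v ω (X₀ i) + backwardEntryTime v ω (X₁ i) < T := by
  -- If all starts, or all targets, lie in `ω`, one family of times vanishes and any pairing is as
  -- good as another.
  by_cases h0 : ∀ i, X₀ i ∈ ω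
  · have := h (τ.symm i)
    rw [Equiv.apply_symm_apply] at this
    rw [entryTime_eq_zero hv (h0 i)]
    linarith [entryTime_nonneg (v := v) (ω := ω) (X₀ (σ (τ.symm i)))]
  by_cases h1 : ∀ i, X₁ i ∈ ω
  · have := h (σ.symm i)
    rw [Equiv.apply_symm_apply] at this
    rw [backwardEntryTime_eq hv, entryTime_eq_zero hv.neg (h1 i)]
    linarith [backwardEntryTime_nonneg hv (ω := ω) (X₁ (τ (σ.symm i)))]
  push Not at h0 h1
  obtain ⟨i₀, hi₀⟩ := h0
  obtain ⟨j₀, hj₀⟩ := h1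
  rcases below_or_below_of_notMem (e := e) hc hi₀ with hb | hb
  · obtain ⟨hf, hg⟩ := entryTimes_ordered_of_below hv hc hX₀ hX₁ hb hj₀
    rw [add_comm]
    exact add_lt_of_forall_perm_add_lt (f := fun i => backwardEntryTime v ω (X₁ i))
      (g := fun i => entryTime v ω (X₀ i)) (fun i j hij => hg i j (he₁.monotone hij))
      (fun i j hij => hf i j (he₀.monotone hij)) τ σ (fun k => by rw [add_comm]; exact h k) i
  · obtain ⟨hf, hg⟩ := entryTimes_ordered_of_below hv hc hX₀ hX₁ hb hj₀
    exact add_lt_of_forall_perm_add_lt (f := fun i => entryTime v ω (X₀ i))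
      (g := fun i => backwardEntryTime v ω (X₁ i))
      (fun i j hij => hf j i (by simpa using he₀.monotone hij))
      (fun i j hij => hg j i (by simpa using he₁.monotone hij)) σ τ h i

/-- On a line, an agent that is still on its way to `ω` stays behind the agents that have left `ω`
for good ahead of it. -/
theorem flow_lt_flow_sub (hv : IsAdmissibleVelocity v) (hω : IsOpen ω) (hc : IsPreconnected ω)
    {x x' y y' : EuclideanSpace ℝ (Fin d)} (hx : e x < e x') (hy : e y < e y')
    (hx' : Reaches v ω x') (hyω : Reaches (-v) ω y)
    (hxy : entryTime v ω x + backwardEntryTime v ω y < T)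
    (hxy' : entryTime v ω x' + backwardEntryTime v ω y' < T)
    (hcross : T ≤ entryTime v ω x + backwardEntryTime v ω y') {s s' t : ℝ}
    (ht0 : 0 ≤ t) (htT : t ≤ T) (hts : t ≤ s) (hst : s' ≤ t) (hsω : flow v s x ∈ ω)
    (hs'ω : flow v (s' - T) y' ∈ ω) : e (flow v t x) < e (flow v (t - T) y') := by
  have hb := backwardEntryTime_nonneg hv (ω := ω) y
  have ha := entryTime_nonneg (v := v) (ω := ω) x'
  have hxn : x ∉ ω := fun h => by
    have := entryTime_eq_zero hv h
    linarith
  have hyn : y' ∉ ω := fun h => by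
    have := entryTime_eq_zero hv.neg h
    rw [← backwardEntryTime_eq hv] at this
    linarith
  have hxb : Below e ω x := (below_or_below_of_notMem hc hxn).resolve_right fun h => by
    have := entryTime_le_of_le hv (e := flipCoord e) (by simpa using hx.le) hx' (Or.inr h)
    linarith
  have hyb : Below (flipCoord e) ω y' := (below_or_below_of_notMem hc hyn).resolve_left fun h => by
    have := entryTime_le_of_le hv.neg hy.le hyω (Or.inr h)
    rw [← backwardEntryTime_eq hv, ← backwardEntryTime_eq hv] at this
    linarith
  rw [← flow_zero hv x] at hxb
  rw [← flow_zero hv y'] at hyb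
  have hm := hxb.monotone_flow hv (ht0.trans hts) hsω
  have hm' := hyb.antitone_flow hv (by linarith) hs'ω
  -- A crossing would squeeze both positions between two points of `ω`. Both would be in `ω` at time
  -- `t`, and openness would give `t⁰ < t` with `t¹ ≤ T - t`, against `hcross`.
  by_contra! hle
  have h1 : e (flow v t x) ≤ e (flow v s x) := hm hts
  have h2 : e (flow v (s' - T) y') ≤ e (flow v (t - T) y') := by
    simpa using hm' (sub_le_sub_right hst T)
  have h3 := mem_of_le_of_le hc hs'ω hsω (h2.trans hle) h1
  have h4 := mem_of_le_of_le hc hs'ω hsω h2 (hle.trans h1)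
  have h5 := entryTime_le ht0 h3
  have h6 : backwardEntryTime v ω y' ≤ T - t := by
    rw [backwardEntryTime_eq hv]
    refine entryTime_le (by linarith) ?_
    rwa [flow_neg hv, neg_sub]
  obtain ⟨r, hr0, hrt, hr⟩ := exists_lt_flow_mem hv hω h3 (c := 0) (by linarith)
  linarith [entryTime_le hr0.le hr]

/-- On a line, an agent that is still on its way to `ω` is not below `ω` if another agent behind it
has reached `ω`. -/
theorem not_below_flow (hv : IsAdmissibleVelocity v) {x x' : EuclideanSpace ℝ (Fin d)}
    (hx : e x < e x') {s s' t : ℝ} (hs0 : 0 ≤ s) (hst : s ≤ t) (hts : t ≤ s') (hs : flow v s x ∈ ω)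
    (hs' : flow v s' x' ∈ ω) : ¬ Below e ω (flow v t x') := by
  intro h
  -- If `x'` were still below, it would be moving up; `x`, lower at time `t` but in `ω` earlier,
  -- would be moving down. Then `x` would start in or above `ω` while `x'` starts below it.
  have hm := h.monotone_flow hv hts hs'
  have hb : Below e ω (flow v t x) := fun w hw => (flow_strictMono hv e hx t).trans (h w hw)
  have ha := hb.antitone_flow hv hst hs
  have h1 : e (flow v s x) ≤ e (flow v 0 x) := ha hs0
  have h2 : e (flow v 0 x') ≤ e (flow v t x') := hm (hs0.trans hst)
  rw [flow_zero hv] at h1 h2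
  linarith [h _ hs]

theorem exists_lt_of_not_below (hω : IsOpen ω) (hc : IsPreconnected ω) (hne : ω.Nonempty)
    {z : EuclideanSpace ℝ (Fin d)} (hz : ¬ Below e ω z) : ∃ w ∈ e '' ω, w < e z := by
  by_cases hzω : z ∈ ω
  · have ho : IsOpen (e '' ω) := e.toHomeomorph.isOpenMap _ hω
    have h2 : ∀ᶠ w in 𝓝[<] (e z), w ∈ Iio (e z) := self_mem_nhdsWithin
    obtain ⟨w, hw, hw'⟩ := ((Filter.Eventually.filter_mono nhdsWithin_le_nhds
      (ho.mem_nhds (mem_image_of_mem e hzω))).and h2).exists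
    exact ⟨w, hw, hw'⟩
  · obtain ⟨w, hw⟩ := hne
    have := (below_or_below_of_notMem (e := e) hc hzω).resolve_left hz w hw
    exact ⟨_, mem_image_of_mem e hw, by simpa using this⟩

end CrowdControl

namespace CrowdControl

/-! ### Ordered curves on a line -/

/-- A partial strictly increasing family can be completed with values in an interval. -/
theorem exists_strictMono_extend {n : ℕ} {I : Set ℝ} (hI : IsOpen I) (hIc : I.OrdConnected)
    (hIne : I.Nonempty) {P : Fin n → Prop} {z : Fin n → ℝ}
    (hz : ∀ i j, P i → P j → i < j → z i < z j)
    (hlo : ∀ i j, ¬ P i → P j → i < j → ∃ w ∈ I, w < z j)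
    (hhi : ∀ i j, ¬ P i → P j → j < i → ∃ w ∈ I, z j < w) :
    ∃ y : Fin n → ℝ, StrictMono y ∧ (∀ i, P i → y i = z i) ∧ ∀ i, ¬ P i → y i ∈ I := by
  classical
  have hlt : ∀ w ∈ I, ∃ w' ∈ I, w' < w := fun w hw => by
    have h1 : ∀ᶠ w' in 𝓝[<] w, w' ∈ I := nhdsWithin_le_nhds (hI.mem_nhds hw)
    have h2 : ∀ᶠ w' in 𝓝[<] w, w' ∈ Iio w := self_mem_nhdsWithin
    exact (h1.and h2).exists
  have hgt : ∀ w ∈ I, ∃ w' ∈ I, w < w' := fun w hw => by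
    have h1 : ∀ᶠ w' in 𝓝[>] w, w' ∈ I := nhdsWithin_le_nhds (hI.mem_nhds hw)
    have h2 : ∀ᶠ w' in 𝓝[>] w, w' ∈ Ioi w := self_mem_nhdsWithin
    exact (h1.and h2).exists
  suffices h : ∀ R : Finset (Fin n), ∃ y : Fin n → ℝ, (∀ i, P i → y i = z i) ∧
      (∀ i ∈ R, ¬ P i → y i ∈ I) ∧ ∀ i j, P i ∨ i ∈ R → P j ∨ j ∈ R → i < j → y i < y j by
    obtain ⟨y, h1, h2, h3⟩ := h Finset.univ
    exact ⟨y, fun i j hij => h3 i j (by simp) (by simp) hij, h1, fun i => h2 i (by simp)⟩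
  intro R
  induction R using Finset.induction_on with
  | empty =>
    exact ⟨z, fun _ _ => rfl, by simp, fun i j hi hj => hz i j (by simpa using hi) (by simpa using hj)⟩
  | insert k R hk ih =>
    obtain ⟨y, h1, h2, h3⟩ := ih
    by_cases hPk : P k
    · have hmem : ∀ i, P i ∨ i ∈ insert k R → P i ∨ i ∈ R := fun i hi => by
        rcases hi with hi | hi
        · exact Or.inl hi
        · rcases Finset.mem_insert.1 hi with rfl | hi
          · exact Or.inl hPk
          · exact Or.inr hi
      exact ⟨y, h1, fun i hi hPi => h2 i ((hmem i (Or.inr hi)).resolve_left hPi) hPi,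
        fun i j hi hj => h3 i j (hmem i hi) (hmem j hj)⟩
    have hex : ∀ j, ∃ w ∈ I, (P j ∨ j ∈ R → (k < j → w < y j) ∧ (j < k → y j < w)) := by
      intro j
      by_cases hj : P j ∨ j ∈ R
      · rcases lt_trichotomy k j with hkj | rfl | hkj
        · obtain ⟨w, hw, hw'⟩ : ∃ w ∈ I, w < y j := by
            by_cases hPj : P j
            · rw [h1 j hPj]
              exact hlo k j hPk hPj hkj
            · exact hlt _ (h2 j (hj.resolve_left hPj) hPj)
          exact ⟨w, hw, fun _ => ⟨fun _ => hw', fun h => absurd h hkj.asymm⟩⟩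
        · obtain ⟨w, hw⟩ := hIne
          exact ⟨w, hw, fun _ => ⟨fun h => absurd h (lt_irrefl _), fun h => absurd h (lt_irrefl _)⟩⟩
        · obtain ⟨w, hw, hw'⟩ : ∃ w ∈ I, y j < w := by
            by_cases hPj : P j
            · rw [h1 j hPj]
              exact hhi k j hPk hPj hkj
            · exact hgt _ (h2 j (hj.resolve_left hPj) hPj)
          exact ⟨w, hw, fun _ => ⟨fun h => absurd h hkj.asymm, fun _ => hw'⟩⟩
      · obtain ⟨w, hw⟩ := hIne
        exact ⟨w, hw, fun h => absurd h hj⟩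
    choose u huI hu using hex
    obtain ⟨p, hp⟩ := hIne
    obtain ⟨p', hp', hpp'⟩ := hgt p hp
    -- The new value is kept between the extremes of `W ⊆ I`, hence in `I`. The pair `p < p'` makes
    -- these extremes distinct even without other constraints.
    set W : Finset ℝ := insert p (insert p' (Finset.univ.image u)) with hW
    have hWI : ∀ w ∈ W, w ∈ I := by
      intro w hw
      simp only [hW, Finset.mem_insert, Finset.mem_image, Finset.mem_univ, true_and] at hw
      rcases hw with rfl | rfl | ⟨j, rfl⟩
      exacts [hp, hp', huI j]
    have hpW : p ∈ W := by simp [hW]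
    have hp'W : p' ∈ W := by simp [hW]
    have huW : ∀ j, u j ∈ W := fun j => by simp [hW]
    have hWne : W.Nonempty := ⟨p, hpW⟩
    obtain ⟨m, hm1, hm2⟩ := Order.exists_between_finsets
      (insert (W.min' hWne) ((Finset.univ.filter fun j => (P j ∨ j ∈ R) ∧ j < k).image y))
      (insert (W.max' hWne) ((Finset.univ.filter fun j => (P j ∨ j ∈ R) ∧ k < j).image y)) (by
        intro a ha b hb
        simp only [Finset.mem_insert, Finset.mem_image, Finset.mem_filter, Finset.mem_univ,
          true_and] at ha hb
        rcases ha with rfl | ⟨i, ⟨hi, hik⟩, rfl⟩ <;> rcases hb with rfl | ⟨j, ⟨hj, hkj⟩, rfl⟩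
        · exact (W.min'_le p hpW).trans_lt (hpp'.trans_le (W.le_max' p' hp'W))
        · exact (W.min'_le _ (huW j)).trans_lt ((hu j hj).1 hkj)
        · exact ((hu i hi).2 hik).trans_le (W.le_max' _ (huW i))
        · exact h3 i j hi hj (hik.trans hkj))
    have hmI : m ∈ I := hIc.out (hWI _ (W.min'_mem hWne)) (hWI _ (W.max'_mem hWne))
      ⟨(hm1 _ (Finset.mem_insert_self _ _)).le, (hm2 _ (Finset.mem_insert_self _ _)).le⟩
    have hmem : ∀ i, i ≠ k → P i ∨ i ∈ insert k R → P i ∨ i ∈ R := fun i hik hi =>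
      hi.imp_right fun h => Finset.mem_of_mem_insert_of_ne h hik
    refine ⟨Function.update y k m, fun i hi => ?_, fun i hi hPi => ?_, fun i j hi hj hij => ?_⟩
    · rw [Function.update_of_ne (by rintro rfl; exact hPk hi)]
      exact h1 i hi
    · by_cases hik : i = k
      · subst hik
        rwa [Function.update_self]
      · rw [Function.update_of_ne hik]
        exact h2 i (Finset.mem_of_mem_insert_of_ne hi hik) hPi
    · by_cases hik : i = k
      · subst hik
        rw [Function.update_self, Function.update_of_ne hij.ne']
        exact hm2 _ (Finset.mem_insert_of_mem (Finset.mem_image_of_mem y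
          (by simpa using ⟨hmem j hij.ne' hj, hij⟩)))
      · rw [Function.update_of_ne hik]
        by_cases hjk : j = k
        · subst hjk
          rw [Function.update_self]
          exact hm1 _ (Finset.mem_insert_of_mem (Finset.mem_image_of_mem y
            (by simpa using ⟨hmem i hik hi, hij⟩)))
        · rw [Function.update_of_ne hjk]
          exact h3 i j (hmem i hik hi) (hmem j hjk hj) hij

open scoped Manifold ContDiff in
/-- Curves on a line that are prescribed outside of some time windows and have to stay in an
interval during these windows can be chosen to be ordered, if the prescribed parts are. -/
theorem exists_ordered_curves {n : ℕ} {I : Set ℝ} (hI : IsOpen I) (hIc : I.OrdConnected)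
    (hIne : I.Nonempty) {a b : Fin n → ℝ → ℝ} (ha : ∀ i, ContDiff ℝ 1 (a i))
    (hb : ∀ i, ContDiff ℝ 1 (b i)) {s s' : Fin n → ℝ} (hs : ∀ i, s i < s' i)
    (haI : ∀ i, a i (s i) ∈ I) (hbI : ∀ i, b i (s' i) ∈ I)
    (haa : ∀ i j, i < j → ∀ t, a i t < a j t) (hbb : ∀ i j, i < j → ∀ t, b i t < b j t)
    (hab : ∀ i j, i < j → ∀ t, t ≤ s i → s' j ≤ t → a i t < b j t)
    (hba : ∀ i j, i < j → ∀ t, s' i ≤ t → t ≤ s j → b i t < a j t)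
    (hlo : ∀ i j, i < j → ∀ t, s i < t → t < s' i →
      (t ≤ s j → ∃ w ∈ I, w < a j t) ∧ (s' j ≤ t → ∃ w ∈ I, w < b j t))
    (hhi : ∀ i j, j < i → ∀ t, s i < t → t < s' i →
      (t ≤ s j → ∃ w ∈ I, a j t < w) ∧ (s' j ≤ t → ∃ w ∈ I, b j t < w)) :
    ∃ x : Fin n → ℝ → ℝ, (∀ i, ContDiff ℝ 1 (x i)) ∧ (∀ i t, t ≤ s i → x i t = a i t) ∧
      (∀ i t, s' i ≤ t → x i t = b i t) ∧ (∀ i, ∀ t ∈ Icc (s i) (s' i), x i t ∈ I) ∧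
      ∀ i j, i < j → ∀ t, x i t < x j t := by
  -- The admissible positions at time `t`. All constraints are convex, so local `C¹` selections can
  -- be glued by a partition of unity.
  set C : ℝ → Set (Fin n → ℝ) := fun t => {y | (∀ i, t ≤ s i → y i = a i t) ∧
    (∀ i, s' i ≤ t → y i = b i t) ∧ (∀ i, t ∈ Icc (s i) (s' i) → y i ∈ I) ∧
    ∀ i j, i < j → y i < y j} with hC
  have hCconv : ∀ t, Convex ℝ (C t) := by
    rintro t y ⟨y1, y2, y3, y4⟩ z ⟨z1, z2, z3, z4⟩ α β hα hβ hαβ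
    refine ⟨fun i hi => ?_, fun i hi => ?_, fun i hi => ?_, fun i j hij => ?_⟩
    · simp only [Pi.add_apply, Pi.smul_apply, smul_eq_mul, y1 i hi, z1 i hi]
      rw [← add_mul, hαβ, one_mul]
    · simp only [Pi.add_apply, Pi.smul_apply, smul_eq_mul, y2 i hi, z2 i hi]
      rw [← add_mul, hαβ, one_mul]
    · exact hIc.convex (y3 i hi) (z3 i hi) hα hβ hαβ
    · simp only [Pi.add_apply, Pi.smul_apply, smul_eq_mul]
      have h1 := y4 i j hij
      have h2 := z4 i j hij
      rcases hα.eq_or_lt with rfl | hα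
      · have : β = 1 := by linarith
        subst this
        linarith
      · exact add_lt_add_of_lt_of_le (mul_lt_mul_of_pos_left h1 hα)
          (mul_le_mul_of_nonneg_left h2.le hβ)
  have hCne : ∀ t, (C t).Nonempty := by
    intro t
    obtain ⟨y, hy, hyP, hyI⟩ := exists_strictMono_extend hI hIc hIne
      (P := fun i => t ≤ s i ∨ s' i ≤ t) (z := fun i => if t ≤ s i then a i t else b i t)
      (fun i j hi hj hij => by
        split_ifs with h1 h2 h2
        · exact haa i j hij t
        · exact hab i j hij t h1 (hj.resolve_left h2)
        · exact hba i j hij t (hi.resolve_left h1) h2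
        · exact hbb i j hij t)
      (fun i j hi hj hij => by
        push Not at hi
        split_ifs with h1
        · exact (hlo i j hij t hi.1 hi.2).1 h1
        · exact (hlo i j hij t hi.1 hi.2).2 (hj.resolve_left h1))
      (fun i j hi hj hij => by
        push Not at hi
        split_ifs with h1
        · exact (hhi i j hij t hi.1 hi.2).1 h1
        · exact (hhi i j hij t hi.1 hi.2).2 (hj.resolve_left h1))
    have ya : ∀ i, t ≤ s i → y i = a i t := fun i hi => by rw [hyP i (Or.inl hi), if_pos hi]
    have yb : ∀ i, s' i ≤ t → y i = b i t := fun i hi => by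
      rw [hyP i (Or.inr hi), if_neg ((hs i).trans_le hi).not_ge]
    refine ⟨y, ya, yb, fun i hi => ?_, fun i j hij => hy hij⟩
    by_cases hP : t ≤ s i ∨ s' i ≤ t
    · rcases hP with h | h
      · rw [ya i h, le_antisymm h hi.1]
        exact haI i
      · rw [yb i h, ← le_antisymm h hi.2]
        exact hbI i
    · exact hyI i hP
  have hloc : ∀ t₀ : ℝ, ∃ U ∈ 𝓝 t₀, ∃ g : ℝ → Fin n → ℝ,
      ContMDiffOn 𝓘(ℝ, ℝ) 𝓘(ℝ, Fin n → ℝ) 1 g U ∧ ∀ t ∈ U, g t ∈ C t := by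
    intro t₀
    obtain ⟨c, c1, c2, c3, c4⟩ := hCne t₀
    -- Near `t₀`, follow the prescribed curve wherever it is imposed at `t₀` and stay constant
    -- otherwise. The prescribed time ranges are closed, so no constraint appears nearby that is
    -- absent at `t₀`; the remaining conditions are open.
    set g : Fin n → ℝ → ℝ := fun i =>
      if t₀ ≤ s i then a i else if s' i ≤ t₀ then b i else fun _ => c i with hg
    have hgd : ∀ i, ContDiff ℝ 1 (g i) := fun i => by
      simp only [hg]
      split_ifs
      exacts [ha i, hb i, contDiff_const]
    have hgc : ∀ i, ContinuousAt (g i) t₀ := fun i => (hgd i).continuous.continuousAt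
    have hg0 : ∀ i, g i t₀ = c i := fun i => by
      simp only [hg]
      split_ifs with h1 h2
      exacts [(c1 i h1).symm, (c2 i h2).symm, rfl]
    have e1 : ∀ i, ∀ᶠ t in 𝓝 t₀, t ≤ s i → g i t = a i t := fun i => by
      rcases le_or_gt t₀ (s i) with h | h
      · exact Filter.Eventually.of_forall fun t _ => by simp only [hg, if_pos h]
      · filter_upwards [Ioi_mem_nhds h] with t ht ht'
        exact absurd ht' (not_le.2 ht)
    have e2 : ∀ i, ∀ᶠ t in 𝓝 t₀, s' i ≤ t → g i t = b i t := fun i => by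
      rcases le_or_gt (s' i) t₀ with h | h
      · exact Filter.Eventually.of_forall fun t _ => by
          simp only [hg, if_neg ((hs i).trans_le h).not_ge, if_pos h]
      · filter_upwards [Iio_mem_nhds h] with t ht ht'
        exact absurd ht' (not_le.2 ht)
    have e3 : ∀ i, ∀ᶠ t in 𝓝 t₀, t ∈ Icc (s i) (s' i) → g i t ∈ I := fun i => by
      by_cases h : t₀ ∈ Icc (s i) (s' i)
      · filter_upwards [(hgc i).eventually_mem (hI.mem_nhds (by rw [hg0]; exact c3 i h))] with t ht _
        exact ht
      · filter_upwards [isClosed_Icc.isOpen_compl.mem_nhds h] with t ht ht'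
        exact absurd ht' ht
    have e4 : ∀ i j, ∀ᶠ t in 𝓝 t₀, i < j → g i t < g j t := fun i j => by
      by_cases h : i < j
      · filter_upwards [(hgc i).eventually_lt (hgc j) (by rw [hg0, hg0]; exact c4 i j h)] with t ht _
        exact ht
      · exact Filter.Eventually.of_forall fun _ h' => absurd h' h
    refine ⟨_, (((Filter.eventually_all.2 e1).and (Filter.eventually_all.2 e2)).and
      (Filter.eventually_all.2 e3)).and (Filter.eventually_all.2 fun i =>
        Filter.eventually_all.2 (e4 i)), fun t i => g i t, ?_, ?_⟩
    · exact ((contDiff_pi.2 hgd).contMDiff).contMDiffOn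
    · rintro t ⟨⟨⟨t1, t2⟩, t3⟩, t4⟩
      exact ⟨t1, t2, t3, t4⟩
  obtain ⟨x, hx⟩ := exists_contMDiffMap_forall_mem_convex_of_local 𝓘(ℝ, ℝ) hCconv hloc
  have hxd : ContDiff ℝ 1 (x : ℝ → Fin n → ℝ) := x.contMDiff.contDiff
  exact ⟨fun i t => x t i, fun i => contDiff_pi.1 hxd i, fun i t => (hx t).1 i,
    fun i t => (hx t).2.1 i, fun i t => (hx t).2.2.1 i, fun i j hij t => (hx t).2.2.2 i j hij⟩

end CrowdControl

/-! ### Steering on a line, and sufficiency of `T > M_e` in every dimension. -/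

namespace CrowdControl

variable {d : ℕ} {v : EuclideanSpace ℝ (Fin d) → EuclideanSpace ℝ (Fin d)}
  {ω : Set (EuclideanSpace ℝ (Fin d))} {n : ℕ} {X₀ X₁ : Fin n → EuclideanSpace ℝ (Fin d)} {T : ℝ}

theorem contDiff_coord_flow (hv : IsAdmissibleVelocity v) (e : EuclideanSpace ℝ (Fin d) ≃L[ℝ] ℝ)
    (x : EuclideanSpace ℝ (Fin d)) : ContDiff ℝ 1 fun t => e (flow v t x) := by
  obtain ⟨L, hL⟩ := hv.lipschitz
  have hd : ∀ t, HasDerivAt (fun t => e (flow v t x)) (e (v (flow v t x))) t := fun t =>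
    e.hasFDerivAt.comp_hasDerivAt t (hasDerivAt_flow hv x t)
  refine contDiff_one_iff_deriv.2 ⟨fun t => (hd t).differentiableAt, ?_⟩
  rw [show deriv (fun t => e (flow v t x)) = fun t => e (v (flow v t x)) from
    funext fun t => (hd t).deriv]
  exact e.continuous.comp (hL.continuous.comp (continuous_flow hv x))

/-- On a line, the agents can be steered in the order preserving pairing within any time that is
larger than all the uncontrollable times. -/
theorem exactlyControllable_of_strictMono (hv : IsAdmissibleVelocity v) (hω : IsOpen ω)
    (hc : IsConnected ω) (hT : 0 ≤ T) (e : EuclideanSpace ℝ (Fin d) ≃L[ℝ] ℝ)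
    (he₀ : StrictMono (fun i => e (X₀ i))) (he₁ : StrictMono (fun i => e (X₁ i)))
    (hX₀ : ∀ i, Reaches v ω (X₀ i)) (hX₁ : ∀ i, Reaches (-v) ω (X₁ i))
    (h : ∀ i, entryTime v ω (X₀ i) + backwardEntryTime v ω (X₁ i) < T) :
    ExactlyControllable v ω X₀ X₁ T := by
  obtain ⟨s, s', hs0, hss', hs'T, hsω, hs'ω, hov⟩ := exists_windows hv hX₀ hX₁ h
  have hpre : ∀ (e : EuclideanSpace ℝ (Fin d) ≃L[ℝ] ℝ) i j t, e (X₀ i) < e (X₀ j) → s i < t →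
      t ≤ s j → ∃ w ∈ e '' ω, w < e (flow v t (X₀ j)) := fun e i j t hij hit htj =>
    exists_lt_of_not_below hω hc.isPreconnected hc.nonempty
      (not_below_flow hv hij (hs0 i) hit.le htj (hsω i) (hsω j))
  have hpost : ∀ (e : EuclideanSpace ℝ (Fin d) ≃L[ℝ] ℝ) i j t, e (X₁ i) < e (X₁ j) → t < s' i →
      s' j ≤ t → ∃ w ∈ e '' ω, w < e (flow v (t - T) (X₁ j)) := fun e i j t hij hit htj => by
    refine exists_lt_of_not_below hω hc.isPreconnected hc.nonempty ?_
    have hs'ω' : ∀ i, flow (-v) (T - s' i) (X₁ i) ∈ ω := fun i => by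
      rw [flow_neg hv, neg_sub]
      exact hs'ω i
    have := not_below_flow hv.neg hij (by linarith [hs'T i]) (sub_le_sub_left hit.le T)
      (sub_le_sub_left htj T) (hs'ω' i) (hs'ω' j)
    rwa [flow_neg hv, neg_sub] at this
  have hflip : ∀ z, (∃ w ∈ flipCoord e '' ω, w < flipCoord e z) → ∃ w ∈ e '' ω, e z < w := by
    rintro z ⟨_, ⟨w, hw, rfl⟩, hlt⟩
    exact ⟨_, mem_image_of_mem e hw, by simpa using hlt⟩
  have hcross : ∀ (e : EuclideanSpace ℝ (Fin d) ≃L[ℝ] ℝ) i j t, e (X₀ i) < e (X₀ j) →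
      e (X₁ i) < e (X₁ j) → t ≤ s i → s' j ≤ t →
      e (flow v t (X₀ i)) < e (flow v (t - T) (X₁ j)) := fun e i j t hij hij' hti htj =>
    flow_lt_flow_sub hv hω hc.isPreconnected hij hij' (hX₀ j) (hX₁ i) (h i) (h j)
      (hov i j (htj.trans hti)) ((hs0 j).trans ((hss' j).le.trans htj))
      (hti.trans ((hss' i).le.trans (hs'T i))) hti htj (hsω i) (hs'ω j)
  have hflip_lt : ∀ {x y}, e x < e y → flipCoord e y < flipCoord e x := fun hxy => by
    simpa using hxy
  obtain ⟨x, hx, hxa, hxb, hxI, hxlt⟩ := exists_ordered_curves (I := e '' ω)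
    (e.toHomeomorph.isOpenMap _ hω) (ordConnected_image hc.isPreconnected) (hc.nonempty.image e)
    (a := fun i t => e (flow v t (X₀ i))) (b := fun i t => e (flow v (t - T) (X₁ i)))
    (fun i => contDiff_coord_flow hv e _)
    (fun i => (contDiff_coord_flow hv e _).comp (contDiff_id.sub contDiff_const)) hss'
    (fun i => mem_image_of_mem e (hsω i)) (fun i => mem_image_of_mem e (hs'ω i))
    (fun i j hij t => flow_strictMono hv e (he₀ hij) t)
    (fun i j hij t => flow_strictMono hv e (he₁ hij) _)
    (fun i j hij t => hcross e i j t (he₀ hij) (he₁ hij))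
    (fun i j hij t hti htj => by
      -- The opposite crossing condition is the same one in the reflected coordinate.
      simpa using hcross (flipCoord e) j i t (hflip_lt (he₀ hij)) (hflip_lt (he₁ hij)) htj hti)
    (fun i j hij t hit hti => ⟨hpre e i j t (he₀ hij) hit, hpost e i j t (he₁ hij) hti⟩)
    (fun i j hij t hit hti =>
      ⟨fun h => hflip _ (hpre (flipCoord e) i j t (hflip_lt (he₀ hij)) hit h),
        fun h => hflip _ (hpost (flipCoord e) i j t (hflip_lt (he₁ hij)) hti h)⟩)
  have hlip : ∀ i, ∃ K, LipschitzOnWith K (fun t => e.symm (x i t)) (Icc 0 T) := fun i => by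
    have h1 : ContDiff ℝ 1 fun t => e.symm (x i t) := e.symm.contDiff.comp (hx i)
    exact h1.locallyLipschitz.locallyLipschitzOn.exists_lipschitzOnWith_of_compact isCompact_Icc
  choose K hK using hlip
  refine exactlyControllable_of_curves hv hω hT (fun i t => e.symm (x i t)) hK
    (fun i j hij t _ heq => ?_) s s' hs0 hs'T (fun i t ht => ?_) (fun i t ht => ?_)
    (fun i t ht => ?_)
  · have heq' := e.symm.injective heq
    rcases lt_or_gt_of_ne hij with hlt | hlt
    · exact (hxlt i j hlt t).ne heq'
    · exact (hxlt j i hlt t).ne' heq'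
  · obtain ⟨w, hw, hwx⟩ := hxI i t ht
    simpa [← hwx] using hw
  · simp [hxa i t ht.2]
  · simp [hxb i t ht.1]

theorem ExactlyControllable.of_comp_perm (α β : Equiv.Perm (Fin n))
    (h : ExactlyControllable v ω (X₀ ∘ α) (X₁ ∘ β) T) : ExactlyControllable v ω X₀ X₁ T := by
  obtain ⟨u, hu, x, hx, σ, hσ⟩ := h
  refine ⟨u, hu, fun i => x (α.symm i), fun i => ?_, (α.symm.trans σ).trans β, fun i => ?_⟩
  · simpa using hx (α.symm i)
  · simpa using hσ (α.symm i)

theorem IsDisjoint.comp_perm (h : IsDisjoint X₀) (α : Equiv.Perm (Fin n)) : IsDisjoint (X₀ ∘ α) :=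
  fun _ _ hij => h _ _ (α.injective.ne hij)

theorem IsDisjoint.strictMono_comp_sort (h : IsDisjoint X₀)
    (e : EuclideanSpace ℝ (Fin d) ≃L[ℝ] ℝ) :
    StrictMono fun i => e ((X₀ ∘ Tuple.sort fun i => e (X₀ i)) i) :=
  (Tuple.monotone_sort fun i => e (X₀ i)).strictMono_of_injective fun i j hij => by
    by_contra hne
    exact h.comp_perm _ i j hne (e.injective hij)

/-- For `d ≥ 2` the pairing sorted by times can be realized directly. For `d = 1` it only serves to
bound the sums of the pairing sorted by position, which is the one realized. -/
theorem exactlyControllable_of_me_lt (hd : 0 < d) (hn : 0 < n) (hv : IsAdmissibleVelocity v)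
    (hω : IsOpen ω) (hc : IsConnected ω) (hd₀ : IsDisjoint X₀) (hd₁ : IsDisjoint X₁)
    (hX₀ : ∀ i, Reaches v ω (X₀ i)) (hX₁ : ∀ i, Reaches (-v) ω (X₁ i))
    (hT : Me v ω X₀ X₁ < T) : ExactlyControllable v ω X₀ X₁ T := by
  set α := Tuple.sort fun j => entryTime v ω (X₀ j) with hα
  set β := Fin.revPerm.trans (Tuple.sort fun j => backwardEntryTime v ω (X₁ j)) with hβ
  have hαβ : ∀ k, entryTime v ω (X₀ (α k)) + backwardEntryTime v ω (X₁ (β k)) < T := fun k =>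
    (le_abs_self _).trans_lt ((le_ciSup (f := fun i =>
      |sortAsc (fun j => entryTime v ω (X₀ j)) i
        + sortDesc (fun j => backwardEntryTime v ω (X₁ j)) i|) (Set.finite_range _).bddAbove
      k).trans_lt hT)
  have hT0 : 0 ≤ T := (add_nonneg (entryTime_nonneg _) (backwardEntryTime_nonneg hv _)).trans
    (hαβ ⟨0, hn⟩).le
  rcases Nat.lt_or_ge 1 d with hd2 | hd1
  · exact (exactlyControllable_of_two_le hd2 hv hω hc.isPreconnected hT0 (hd₀.comp_perm α)
      (hd₁.comp_perm β) (fun i => hX₀ _) (fun i => hX₁ _) hαβ).of_comp_perm α β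
  · obtain ⟨e⟩ : Nonempty (EuclideanSpace ℝ (Fin d) ≃L[ℝ] ℝ) :=
      FiniteDimensional.nonempty_continuousLinearEquiv_of_finrank_eq (by simp; omega)
    have he₀ := hd₀.strictMono_comp_sort e
    have he₁ := hd₁.strictMono_comp_sort e
    set α' := Tuple.sort fun i => e (X₀ i)
    set β' := Tuple.sort fun i => e (X₁ i)
    refine (exactlyControllable_of_strictMono hv hω hc hT0 e he₀ he₁ (fun i => hX₀ _)
      (fun i => hX₁ _) (add_lt_of_strictMono hv hc.isPreconnected (fun i => hX₀ _) (fun i => hX₁ _)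
        he₀ he₁ (α.trans α'.symm) (β.trans β'.symm) fun k => ?_)).of_comp_perm α' β'
    simpa using hαβ k

end CrowdControl

theorem theorem1 {d n : ℕ} (hd : 0 < d) (hn : 0 < n)
    (v : EuclideanSpace ℝ (Fin d) → EuclideanSpace ℝ (Fin d))
    (hv : CrowdControl.IsAdmissibleVelocity v)
    (ω : Set (EuclideanSpace ℝ (Fin d)))
    (hω_bounded : Bornology.IsBounded ω) (hω_open : IsOpen ω) (hω_conn : IsConnected ω)
    (X₀ X₁ : Fin n → EuclideanSpace ℝ (Fin d))
    (hX₀ : CrowdControl.IsDisjoint X₀) (hX₁ : CrowdControl.IsDisjoint X₁)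
    (hgeo : CrowdControl.GeometricCondition v ω
      (CrowdControl.empiricalMeasure X₀) (CrowdControl.empiricalMeasure X₁)) :
    (∀ T : ℝ, CrowdControl.Me v ω X₀ X₁ < T → CrowdControl.ExactlyControllable v ω X₀ X₁ T) ∧
    (∀ T : ℝ, T ∈ Set.Ioc (CrowdControl.MeStar v ω X₀ X₁) (CrowdControl.Me v ω X₀ X₁) →
      ¬ CrowdControl.ExactlyControllable v ω X₀ X₁ T) ∧
    {T : ℝ | T ∈ Set.Icc 0 (CrowdControl.MeStar v ω X₀ X₁) ∧
      CrowdControl.ExactlyControllable v ω X₀ X₁ T}.Finite := by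
  have h₀ : ∀ i, CrowdControl.Reaches v ω (X₀ i) := fun i =>
    hgeo.forward _ (CrowdControl.mem_support_empiricalMeasure X₀ i)
  have h₁ : ∀ i, CrowdControl.Reaches (-v) ω (X₁ i) := fun i => by
    obtain ⟨t, ht, h⟩ := hgeo.backward _ (CrowdControl.mem_support_empiricalMeasure X₁ i)
    exact ⟨t, ht, by rwa [CrowdControl.flow_neg hv]⟩
  refine ⟨fun T hT => ?_, fun T hT h => ?_, ?_⟩
  · exact CrowdControl.exactlyControllable_of_me_lt hd hn hv hω_open hω_conn hX₀ hX₁ h₀ h₁ hT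
  · exact (h.me_lt hn hv hω_open h₀ hT.1).not_ge hT.2
  · exact CrowdControl.finite_setOf_exactlyControllable_le_meStar hn hv h₀ h₁
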